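/- Let $\mathbb X$ be a complex Banach space, $n\ge 0$ an integer, $0<\alpha\le 1$, and $A$ a closed linear operator in $\mathbb X$ with domain $D(A)$ (not necessarily bounded or densely defined). Let $BUC_n(\mathbb R^+,\mathbb X)$ be the Banach space of continuous functions $h:\mathbb R^+=[0,\infty)\to\mathbb X$ with $$\|h\|_n:=\sup_{t\ge 0}\frac{\|h(t)\|}{(1+t)^n}<\infty ,\qquad \lim_{s\downarrow 0}\sup_{t\ge 0}\frac{\|h(t+s)-h(t)\|}{(1+t)^n}=0,$$ with norm $\|\cdot\|_n$, and let $C_{0,n}(\mathbb R^+,\mathbb X)$ be the set of those $h\in BUC_n(\mathbb R^+,\mathbb X)$ with $\|h(t)\|/(1+t)^n\to 0$ as $t\to\infty$. Let $\mathcal D=d/dt$ be the differentiation operator in $BUC_n(\mathbb R^+,\mathbb X)$ with domain $\{h: h'\text{ exists and } h'\in BUC_n(\mathbb R^+,\mathbb X)\}$, and write $R(\lambda,\mathcal D)=(\lambda-\mathcal D)^{-1}$ (which exists for $\Re\lambda>0$). A function $h\in BUC_n(\mathbb R^+,\mathbb X)$ is called $n$-uniformly ergodic at $i\eta$ $(\eta\in\mathbb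 R)$ with mean $M_\eta(h)$ if the limit $$M_\eta(h):=\lim_{a\downarrow 0} a\,R(a+i\eta,\mathcal D)h$$ exists in $BUC_n(\mathbb R^+,\mathbb X)$. Let $\rho(A,\alpha)$ be the set of all $\xi\in\mathbb C$ such that, for all $\lambda$ in a neighbourhood of $\xi$, the operator $\lambda^\alpha-A$ has an everywhere defined bounded inverse, and $\lambda\mapsto(\lambda^\alpha-A)^{-1}$ is analytic in that neighbourhood (with the principal branch of $\lambda^\alpha$), and let $\Sigma(A,\alpha):=\mathbb C\setminus\rho(A,\alpha)$. A mild solution on $\mathbb R^+$ of the Caputo fractional equation $D^\alpha_C u=Au+f$ is a continuous function $u:\mathbb R^+\to\mathbb X$ such that, for every $t\ge 0$, $J^\alpha u(t)\in D(A)$ and $$u(t)=AJ^\alpha u(t)+J^\alpha f(t)+u(0),\qquad\text{where } J^\alpha v(t)=\frac1{\Gamma(\alpha)}\int_0^t (t-\tau)^{\alpha-1}v(\tau)\,d\tau .$$ \textbf{Theorem.} Let $f\in C_{0,n}(\mathbb R^+,\mathbb X)$ and let $u\in BUC_n(\mathbb R^+,\mathbb X)$ be a mild solution of $D^\alpha_C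 u=Au+f$. Assume that (i) $\Sigma(A,\alpha)\cap i\mathbb R$ is countable; (ii) at each point $i\eta$ of $\Sigma(A,\alpha)\cap i\mathbb R$, $u$ is $n$-uniformly ergodic with $M_\eta(u)=0$. Then $$\lim_{t\to\infty}\frac{1}{(1+t)^n}\,u(t)=0 .$$ -/

import Mathlib

open Filter Topology Set
open scoped NNReal

noncomputable section

namespace FracStab

/-! ### Unbounded operators and their resolvents -/

/-- `R` is the bounded, everywhere defined, two-sided inverse of `z - T`, for a (possibly
unbounded) linear operator `T` with domain `T.domain`. -/
def IsResolvent {E : Type*} [NormedAddCommGroup E] [NormedSpace ℂ E]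
    (T : E →ₗ.[ℂ] E) (z : ℂ) (R : E →L[ℂ] E) : Prop :=
  (∀ x : E, ∃ h : R x ∈ T.domain, z • R x - T ⟨R x, h⟩ = x) ∧
    ∀ x : T.domain, R (z • (x : E) - T x) = x

/-- There is at most one resolvent at each point. -/
theorem IsResolvent.unique {E : Type*} [NormedAddCommGroup E] [NormedSpace ℂ E]
    {T : E →ₗ.[ℂ] E} {z : ℂ} {R S : E →L[ℂ] E}
    (hR : IsResolvent T z R) (hS : IsResolvent T z S) : R = S := by
  ext x
  obtain ⟨h, hx⟩ := hR.1 x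
  have h2 := hS.2 ⟨R x, h⟩
  simp only [hx] at h2
  exact h2.symm

open Classical in
/-- The resolvent `R(z, T) = (z - T)⁻¹` (with the value `0` outside the resolvent set). -/
def resolventOp {E : Type*} [NormedAddCommGroup E] [NormedSpace ℂ E]
    (T : E →ₗ.[ℂ] E) (z : ℂ) : E →L[ℂ] E :=
  if h : ∃ R : E →L[ℂ] E, IsResolvent T z R then h.choose else 0

theorem IsResolvent.resolventOp_eq {E : Type*} [NormedAddCommGroup E] [NormedSpace ℂ E]
    {T : E →ₗ.[ℂ] E} {z : ℂ} {R : E →L[ℂ] E} (hR : IsResolvent T z R) :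
    resolventOp T z = R := by
  have h : ∃ R : E →L[ℂ] E, IsResolvent T z R := ⟨R, hR⟩
  rw [resolventOp, dif_pos h]
  exact h.choose_spec.unique hR

/-- `ρ(A, α)`: the points `ξ` in a neighbourhood of which `z ↦ (z ^ α - A)⁻¹` exists and is
analytic (in operator norm). The power is the principal branch. -/
def rhoSet {X : Type*} [NormedAddCommGroup X] [NormedSpace ℂ X]
    (A : X →ₗ.[ℂ] X) (α : ℝ) : Set ℂ :=
  {ξ | ∃ U : Set ℂ, IsOpen U ∧ ξ ∈ U ∧ ∃ R : ℂ → X →L[ℂ] X,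
    (∀ z ∈ U, IsResolvent A (z ^ (α : ℂ)) (R z)) ∧ AnalyticOnNhd ℂ R U}

/-- `Σ(A, α) = ℂ \ ρ(A, α)`. -/
def sigmaSet {X : Type*} [NormedAddCommGroup X] [NormedSpace ℂ X]
    (A : X →ₗ.[ℂ] X) (α : ℝ) : Set ℂ :=
  (rhoSet A α)ᶜ

/-! ### Fractional integrals and mild solutions -/

/-- The Riemann-Liouville integral
`J^α u (t) = ∫_0^t (t - τ)^(α - 1) / Γ(α) u(τ) dτ` of a function on the half line. -/
def fracInt {X : Type*} [NormedAddCommGroup X] [NormedSpace ℂ X]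
    (α : ℝ) (u : ℝ≥0 → X) (t : ℝ≥0) : X :=
  ∫ τ in (0 : ℝ)..(t : ℝ), (((t : ℝ) - τ) ^ (α - 1) / Real.Gamma α) • u τ.toNNReal

/-- `u` is a mild solution on the half line of `D^α_C u = A u + f`. -/
def IsMildSolution {X : Type*} [NormedAddCommGroup X] [NormedSpace ℂ X]
    (A : X →ₗ.[ℂ] X) (α : ℝ) (f u : ℝ≥0 → X) : Prop :=
  Continuous u ∧ ∀ t : ℝ≥0, ∃ h : fracInt α u t ∈ A.domain,
    u t = A ⟨fracInt α u t, h⟩ + fracInt α f t + u 0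

/-! ### The Banach space `BUC_n` -/

/-- `sup_t ‖f t‖ / (1 + t)^n < ∞`. -/
def NBounded {X : Type*} [NormedAddCommGroup X] (n : ℕ) (f : ℝ≥0 → X) : Prop :=
  BddAbove (range fun t : ℝ≥0 => ‖f t‖ / (1 + (t : ℝ)) ^ n)

/-- `f` is continuous and `sup_t ‖f (t + h) - f t‖ / (1 + t)^n → 0` as `h ↓ 0`. -/
def NUniformContinuous {X : Type*} [NormedAddCommGroup X] (n : ℕ) (f : ℝ≥0 → X) : Prop :=
  Continuous f ∧ ∀ ε : ℝ, 0 < ε → ∃ δ : ℝ≥0, 0 < δ ∧ ∀ h : ℝ≥0, 0 < h → h < δ →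
    ∀ t : ℝ≥0, ‖f (t + h) - f t‖ / (1 + (t : ℝ)) ^ n ≤ ε

/-- The vector space of `n`-bounded, `n`-uniformly continuous functions on the half line. -/
def bucSubmodule (n : ℕ) (X : Type*) [NormedAddCommGroup X] [NormedSpace ℂ X] :
    Submodule ℂ (ℝ≥0 → X) where
  carrier := {f | NBounded n f ∧ NUniformContinuous n f}
  zero_mem' := by
    refine ⟨⟨0, ?_⟩, continuous_const, fun ε hε => ⟨1, one_pos, fun h _ _ t => ?_⟩⟩
    · rintro _ ⟨t, rfl⟩
      simp
    · simpa using hε.le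
  add_mem' := by
    rintro f g ⟨⟨C, hC⟩, hfc, hf⟩ ⟨⟨C', hC'⟩, hgc, hg⟩
    refine ⟨⟨C + C', ?_⟩, hfc.add hgc, fun ε hε => ?_⟩
    · rintro _ ⟨t, rfl⟩
      have h1 := hC ⟨t, rfl⟩
      have h2 := hC' ⟨t, rfl⟩
      have h3 : ‖(f + g) t‖ / (1 + (t : ℝ)) ^ n
          ≤ ‖f t‖ / (1 + (t : ℝ)) ^ n + ‖g t‖ / (1 + (t : ℝ)) ^ n := by
        rw [← add_div]
        gcongr
        exact norm_add_le _ _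
      simp only at h1 h2 ⊢
      linarith
    · obtain ⟨δ, hδ, h1⟩ := hf (ε / 2) (by positivity)
      obtain ⟨δ', hδ', h2⟩ := hg (ε / 2) (by positivity)
      refine ⟨min δ δ', lt_min hδ hδ', fun h h0 hh t => ?_⟩
      have h3 := h1 h h0 (hh.trans_le (min_le_left _ _)) t
      have h4 := h2 h h0 (hh.trans_le (min_le_right _ _)) t
      have h5 : ‖(f + g) (t + h) - (f + g) t‖ / (1 + (t : ℝ)) ^ n
          ≤ ‖f (t + h) - f t‖ / (1 + (t : ℝ)) ^ n
            + ‖g (t + h) - g t‖ / (1 + (t : ℝ)) ^ n := by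
        rw [← add_div]
        gcongr
        simp only [Pi.add_apply]
        rw [add_sub_add_comm]
        exact norm_add_le _ _
      linarith
  smul_mem' := by
    rintro c f ⟨⟨C, hC⟩, hfc, hf⟩
    refine ⟨⟨‖c‖ * C, ?_⟩, hfc.const_smul c, fun ε hε => ?_⟩
    · rintro _ ⟨t, rfl⟩
      have h1 := hC ⟨t, rfl⟩
      simp only [Pi.smul_apply, norm_smul, mul_div_assoc] at h1 ⊢
      gcongr
    · obtain ⟨δ, hδ, h1⟩ := hf (ε / (‖c‖ + 1)) (by positivity)
      refine ⟨δ, hδ, fun h h0 hh t => ?_⟩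
      have h3 := h1 h h0 hh t
      simp only [Pi.smul_apply, ← smul_sub, norm_smul, mul_div_assoc]
      calc ‖c‖ * (‖f (t + h) - f t‖ / (1 + (t : ℝ)) ^ n)
          ≤ (‖c‖ + 1) * (ε / (‖c‖ + 1)) := by gcongr; linarith
        _ = ε := by field_simp

/-- The space `BUC_n(ℝ⁺, X)`. It is a separate type so that it carries only the topology of the
weighted sup-norm defined below (and not that of pointwise convergence). -/
def BUC (n : ℕ) (X : Type*) [NormedAddCommGroup X] [NormedSpace ℂ X] : Type _ :=
  ↥(bucSubmodule n X)

section

variable {n : ℕ} {X : Type*} [NormedAddCommGroup X] [NormedSpace ℂ X]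

instance : AddCommGroup (BUC n X) := inferInstanceAs (AddCommGroup ↥(bucSubmodule n X))

instance : Module ℂ (BUC n X) := inferInstanceAs (Module ℂ ↥(bucSubmodule n X))

instance : CoeFun (BUC n X) fun _ => ℝ≥0 → X := ⟨fun f => f.1⟩

theorem BUC.coe_add (f g : BUC n X) (t : ℝ≥0) : (f + g) t = f t + g t := rfl

theorem BUC.coe_smul (c : ℂ) (f : BUC n X) (t : ℝ≥0) : (c • f) t = c • f t := rfl

theorem BUC.coe_neg (f : BUC n X) (t : ℝ≥0) : (-f) t = -f t := rfl

theorem BUC.coe_zero (t : ℝ≥0) : (0 : BUC n X) t = 0 := rfl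

theorem BUC.ext {f g : BUC n X} (h : ∀ t, f t = g t) : f = g := Subtype.ext (funext h)

/-- `‖f‖_n = sup_t ‖f t‖ / (1 + t)^n`. -/
def bucNorm (f : BUC n X) : ℝ := ⨆ t : ℝ≥0, ‖f t‖ / (1 + (t : ℝ)) ^ n

theorem le_bucNorm (f : BUC n X) (t : ℝ≥0) : ‖f t‖ / (1 + (t : ℝ)) ^ n ≤ bucNorm f :=
  le_ciSup f.2.1 t

theorem bucNorm_smul_le (c : ℂ) (f : BUC n X) : bucNorm (c • f) ≤ ‖c‖ * bucNorm f := by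
  refine ciSup_le fun t => ?_
  rw [BUC.coe_smul, norm_smul, mul_div_assoc]
  exact mul_le_mul_of_nonneg_left (le_bucNorm f t) (norm_nonneg c)

instance : NormedAddCommGroup (BUC n X) :=
  AddGroupNorm.toNormedAddCommGroup
    { toFun := bucNorm
      map_zero' := by simp [bucNorm, BUC.coe_zero]
      add_le' := fun f g => ciSup_le fun t => by
        refine le_trans ?_ (add_le_add (le_bucNorm f t) (le_bucNorm g t))
        rw [← add_div, BUC.coe_add]
        gcongr
        exact norm_add_le _ _
      neg' := fun f => by simp [bucNorm, BUC.coe_neg]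
      eq_zero_of_map_eq_zero' := fun f hf => BUC.ext fun t => by
        have h1 := le_bucNorm f t
        rw [hf] at h1
        have h2 : 0 < (1 + (t : ℝ)) ^ n := by positivity
        rw [div_le_iff₀ h2, zero_mul] at h1
        exact norm_le_zero_iff.1 h1 }

instance : NormedSpace ℂ (BUC n X) where
  norm_smul_le := bucNorm_smul_le

/-- `C_{0,n}`: the elements of `BUC_n` with `‖f t‖ / (1 + t)^n → 0` as `t → ∞`. -/
def IsC0 (f : BUC n X) : Prop :=
  Tendsto (fun t : ℝ≥0 => ‖f t‖ / (1 + (t : ℝ)) ^ n) atTop (𝓝 0)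

/-! ### The differentiation operator and ergodicity -/

variable (n X) in
/-- The graph of differentiation in `BUC_n`: the pairs `(f, g)` with `f' = g` on `[0, ∞)`
(a one-sided derivative at `0`). -/
def diffGraph : Submodule ℂ (BUC n X × BUC n X) where
  carrier := {p | ∀ t : ℝ≥0,
    HasDerivWithinAt (fun s : ℝ => p.1 s.toNNReal) (p.2 t) (Ici 0) (t : ℝ)}
  zero_mem' := fun _ => hasDerivWithinAt_const _ _ _
  add_mem' := fun ha hb t => (ha t).add (hb t)
  smul_mem' := fun c _ ha t => (ha t).const_smul c

theorem diffGraph_functional (p : BUC n X × BUC n X) (hp : p ∈ diffGraph n X)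
    (h0 : p.1 = 0) : p.2 = 0 := by
  refine BUC.ext fun t => ?_
  have h1 := hp t
  rw [h0] at h1
  exact (uniqueDiffOn_Ici (0 : ℝ) (t : ℝ) t.2).eq_deriv _ h1
    (hasDerivWithinAt_const (t : ℝ) (Ici 0) (0 : X))

variable (n X) in
/-- The operator `𝒟 = d/dt` in `BUC_n`, with domain the `f` such that `f' ∈ BUC_n`. -/
def diffOp : BUC n X →ₗ.[ℂ] BUC n X := (diffGraph n X).toLinearPMap

theorem diffOp_graph : (diffOp n X).graph = diffGraph n X :=
  Submodule.toLinearPMap_graph_eq _ diffGraph_functional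

/-- `h` is `n`-uniformly ergodic at `iη` with mean `M_η(h) = M`:
`a R(a + iη, 𝒟) h → M` in the norm of `BUC_n` as `a ↓ 0`. -/
def HasErgodicMean (η : ℝ) (h M : BUC n X) : Prop :=
  Tendsto (fun a : ℝ => (a : ℂ) • resolventOp (diffOp n X) ((a : ℂ) + Complex.I * (η : ℂ)) h)
    (𝓝[>] 0) (𝓝 M)

end

end FracStab

end

open scoped NNReal BoundedContinuousFunction
open MeasureTheory

noncomputable section

namespace FracStab

/-! ### A Tauberian theorem with a countable set of singularities -/

/-! The weighted function w(t) = (1+t)^(-n) u(t) is bounded and uniformly continuous, and the claim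
is that it lies in the subspace C₀ of functions vanishing at infinity. By Hahn-Banach
(`tendsto_zero_of_forall_functional`) it is enough that every continuous functional φ killing C₀
also kills w. Fix φ and put U(s) = φ(translate of w by s) for all real s. Negative translations are
truncated at the origin, which changes nothing modulo C₀, so translation acts like a group under φ
and U is a bounded continuous function on the whole line with U(0) = φ(w). Differentiating the
weight costs a factor n/(1+t), also invisible to φ.

The Carleman transform of U is analytic off the imaginary axis and is O(1/|Re z|). Its singularities
on the axis lie in Σ(A, α), for the following reason. If y is n-bounded and y' = z y - u + e with e
negligible at infinity, then variation of constants shows that φ of the weighted y is the Carleman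
transform at z, on either side of the axis (`apply_eq_carleman`). An analytic family z ↦ y_z of such
solutions near a regular point is therefore an analytic continuation. For α = 1 one takes y_z = (z -
A)⁻¹u. For α < 1 one takes y_z = (z^α - A)⁻¹Q_z, where formally Q_z has Laplace transform (λ^α -
z^α)/(λ - z) times that of u. It is realised as an n-bounded function by superposing the
convolutions e^(-rt) * u with density r^α/(r+z) over Γ(α)Γ(1-α) (`smul_integral_expConvStieltjes`).
The origin, where z^α branches, is regular only if X = 0 (`eq_zero_of_zero_mem_rhoSet`).

In the right half plane the choice y = R(z, 𝒟)u shows that vanishing ergodic means say a·Û(iη + a) →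
0 as a ↓ 0. The bound O(1/|Re z|) makes an isolated singularity at worst a simple pole, so it is
then removable. A nonempty closed countable set has an isolated point, so there are no singularities
at all. The same bound on large circles makes the entire extension zero
(`eq_zero_of_countable_singularities`), and U(0) = lim a·Û(a) = 0. -/

/-- On a circle centred on the imaginary axis, the factor `1 + ((z - c) / r) ^ 2` compensates a
singularity of order `1 / |Re z|`. -/
theorem norm_one_add_sq_mul_le {F : ℂ → ℂ} {c : ℂ} (hc : c.re = 0) {r C : ℝ} (hr : 0 < r)
    (hC : 0 ≤ C) (hd : DiffContOnCl ℂ F (Metric.ball c r))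
    (hb : ∀ z ∈ Metric.closedBall c r, z.re ≠ 0 → ‖F z‖ ≤ C / |z.re|)
    {z : ℂ} (hz : z ∈ Metric.closedBall c r) :
    ‖(1 + ((z - c) / r) ^ 2) * F z‖ ≤ 2 * C / r := by
  have hr' : (r : ℂ) ≠ 0 := by exact_mod_cast hr.ne'
  have hd' : DiffContOnCl ℂ (fun z => (1 + ((z - c) / r) ^ 2) * F z) (Metric.ball c r) := by
    have h1 : Differentiable ℂ (fun z : ℂ => 1 + ((z - c) / r) ^ 2) := by fun_prop
    exact h1.diffContOnCl.smul hd
  refine Complex.norm_le_of_forall_mem_frontier_norm_le Metric.isBounded_ball hd' ?_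
    (by rwa [closure_ball c hr.ne'])
  intro z hz
  rw [frontier_ball c hr.ne', mem_sphere_iff_norm] at hz
  -- On the circle r² = (z - c) · conj(z - c), and c has real part 0, so the factor equals (z - c) ·
  -- 2 Re z / r². It vanishes exactly fast enough to absorb 1/|Re z|, and the maximum principle does
  -- the rest.
  have h1 : ‖1 + ((z - c) / r) ^ 2‖ = 2 * |z.re| / r := by
    have h2 : (1 : ℂ) + ((z - c) / r) ^ 2 = (z - c) * (2 * z.re : ℝ) / r ^ 2 := by
      have h3 : (z - c) * (starRingEnd ℂ) (z - c) = (r : ℂ) ^ 2 := by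
        rw [Complex.mul_conj, Complex.normSq_eq_norm_sq, hz]; push_cast; ring
      have h4 : (z - c) + (starRingEnd ℂ) (z - c) = (2 * z.re : ℝ) := by
        rw [Complex.add_conj]; simp [hc]
      rw [← h4, mul_add, h3]
      field_simp
      ring
    rw [h2, norm_div, norm_mul, hz, norm_pow, Complex.norm_real, Complex.norm_real,
      Real.norm_eq_abs, Real.norm_eq_abs, abs_mul, abs_of_pos hr]
    simp only [abs_two]
    field_simp
  rw [norm_mul, h1]
  by_cases h0 : z.re = 0
  · simp [h0]; positivity
  · have h2 : 0 < |z.re| := abs_pos.2 h0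
    calc 2 * |z.re| / r * ‖F z‖ ≤ 2 * |z.re| / r * (C / |z.re|) := by
          gcongr
          exact hb z (Metric.sphere_subset_closedBall (by simpa [mem_sphere_iff_norm] using hz)) h0
      _ = 2 * C / r := by field_simp

/-! ### Analytic extension across the imaginary axis -/

/-- `G`, given off the imaginary axis, extends analytically to a neighbourhood of `c`. -/
def ExtendsAt (G : ℂ → ℂ) (c : ℂ) : Prop :=
  ∃ F : ℂ → ℂ, AnalyticAt ℂ F c ∧ ∀ᶠ z in 𝓝 c, z.re ≠ 0 → F z = G z

theorem frequently_re_ne (c : ℂ) : (𝓝[{z : ℂ | z.re ≠ 0}] c).NeBot := by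
  rw [← mem_closure_iff_nhdsWithin_neBot]
  have h : Dense {z : ℂ | z.re ≠ 0} := by
    have h1 : Dense ({0}ᶜ : Set ℝ) := dense_compl_singleton 0
    exact h1.preimage Complex.isOpenMap_re
  exact h c

/-- The extension of `G` to the regular points of the imaginary axis. -/
def axisExtension (G : ℂ → ℂ) (c : ℂ) : ℂ := limUnder (𝓝[{z : ℂ | z.re ≠ 0}] c) G

/-- Off-axis points accumulate at every point, so any continuous extension is forced to be the
limit. This lets the local extensions in `ExtendsAt` be glued into a single function. -/
theorem axisExtension_eq {G F : ℂ → ℂ} {c : ℂ} (hF : ContinuousAt F c)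
    (h : ∀ᶠ z in 𝓝 c, z.re ≠ 0 → F z = G z) : axisExtension G c = F c := by
  have := frequently_re_ne c
  refine Tendsto.limUnder_eq ?_
  refine (hF.tendsto.mono_left nhdsWithin_le_nhds).congr' ?_
  exact eventually_nhdsWithin_iff.2 (h.mono fun z hz hz' => hz hz')

theorem ExtendsAt.eventually_eq {G F : ℂ → ℂ} {c : ℂ} (hF : AnalyticAt ℂ F c)
    (h : ∀ᶠ z in 𝓝 c, z.re ≠ 0 → F z = G z) : axisExtension G =ᶠ[𝓝 c] F := by
  filter_upwards [hF.eventually_analyticAt, h.eventually_nhds] with z hz hz'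
  exact axisExtension_eq hz.continuousAt hz'

theorem ExtendsAt.analyticAt {G : ℂ → ℂ} {c : ℂ} (h : ExtendsAt G c) :
    AnalyticAt ℂ (axisExtension G) c := by
  obtain ⟨F, hF, h⟩ := h
  exact hF.congr (ExtendsAt.eventually_eq hF h).symm

theorem isOpen_extendsAt (G : ℂ → ℂ) : IsOpen {c | ExtendsAt G c} := by
  rw [isOpen_iff_mem_nhds]
  rintro c ⟨F, hF, h⟩
  filter_upwards [hF.eventually_analyticAt, h.eventually_nhds] with z hz hz'
  exact ⟨F, hz, hz'⟩

/-- An isolated singularity on the imaginary axis is a simple pole at worst, and it is removable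
if the residue vanishes. -/
theorem extendsAt_of_punctured {G : ℂ → ℂ} {C : ℝ} (hC : 0 ≤ C)
    (hG : ∀ z, z.re ≠ 0 → axisExtension G z = G z)
    (hb : ∀ z, z.re ≠ 0 → ‖G z‖ ≤ C / |z.re|) {c : ℂ} (hc : c.re = 0) {ρ : ℝ} (hρ : 0 < ρ)
    (hreg : ∀ z ∈ Metric.ball c ρ, z ≠ c → ExtendsAt G z)
    (herg : Tendsto (fun a : ℝ => (a : ℂ) * G (c + a)) (𝓝[>] 0) (𝓝 0)) : ExtendsAt G c := by
  set H := axisExtension G with hH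
  have hHb : ∀ z, z.re ≠ 0 → ‖H z‖ ≤ C / |z.re| := fun z hz => by rw [hG z hz]; exact hb z hz
  have hbound : ∀ z ∈ Metric.ball c (ρ / 2), z ≠ c → ‖(z - c) * H z‖ ≤ 6 * C := by
    intro z hz hzc
    rw [mem_ball_iff_norm] at hz
    have hpos : 0 < ‖z - c‖ := norm_pos_iff.2 (sub_ne_zero.2 hzc)
    rw [norm_mul]
    -- Away from the axis the a priori bound is already of order 1/‖z - c‖. Close to the axis the
    -- circle estimate is used, centred at the projection d of z to the axis with radius half the
    -- distance to c: this disc avoids c and stays inside the ball of radius ρ.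
    by_cases hre : ‖z - c‖ / 4 ≤ |z.re|
    · have h0 : 0 < |z.re| := lt_of_lt_of_le (by positivity) hre
      calc ‖z - c‖ * ‖H z‖ ≤ (4 * |z.re|) * (C / |z.re|) := by
            gcongr
            · linarith
            · exact hHb z (abs_pos.1 h0)
        _ = 4 * C := by field_simp
        _ ≤ 6 * C := by linarith
    · push Not at hre
      set d : ℂ := ⟨0, z.im⟩ with hd
      set r : ℝ := ‖z - c‖ / 2 with hr
      have hr0 : 0 < r := by positivity
      have hzd : z - d = (z.re : ℂ) := by apply Complex.ext <;> simp [hd]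
      have hzd' : ‖z - d‖ = |z.re| := by rw [hzd, Complex.norm_real, Real.norm_eq_abs]
      have hball : ∀ x ∈ Metric.closedBall d r, ExtendsAt G x := by
        intro x hx
        rw [mem_closedBall_iff_norm] at hx
        have e1 : ‖x - c‖ ≤ ‖x - d‖ + ‖z - d‖ + ‖z - c‖ := by
          calc ‖x - c‖ = ‖(x - d) - (z - d) + (z - c)‖ := by congr 1; ring
            _ ≤ _ := (norm_add_le _ _).trans (by gcongr; exact norm_sub_le _ _)
        have e2 : ‖z - c‖ ≤ ‖x - d‖ + ‖z - d‖ + ‖x - c‖ := by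
          calc ‖z - c‖ = ‖(z - d) - (x - d) + (x - c)‖ := by congr 1; ring
            _ ≤ _ := (norm_add_le _ _).trans (by
              gcongr; rw [add_comm]; exact norm_sub_le _ _)
        refine hreg x (mem_ball_iff_norm.2 ?_) ?_
        · rw [hzd'] at e1; linarith
        · rintro rfl
          rw [sub_self, norm_zero, hzd'] at e2; linarith
      have hdc : DiffContOnCl ℂ H (Metric.ball d r) := by
        refine DifferentiableOn.diffContOnCl fun x hx => ?_
        rw [closure_ball d hr0.ne'] at hx
        exact (hball x hx).analyticAt.differentiableAt.differentiableWithinAt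
      have key := norm_one_add_sq_mul_le (c := d) (by simp [hd]) hr0 hC hdc
        (fun x _ hx => hHb x hx) (z := z)
        (mem_closedBall_iff_norm.2 (by rw [hzd']; linarith))
      -- Here |z - d| ≤ r/2, so the compensating factor is bounded below by 1 - 1/4.
      have h34 : 3 / 4 ≤ ‖1 + ((z - d) / r) ^ 2‖ := by
        have : ‖((z - d) / (r : ℂ)) ^ 2‖ ≤ 1 / 4 := by
          rw [norm_pow, norm_div, hzd', Complex.norm_real, Real.norm_eq_abs, abs_of_pos hr0]
          have : |z.re| / r ≤ 1 / 2 := by rw [div_le_iff₀ hr0]; linarith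
          calc (|z.re| / r) ^ 2 ≤ (1 / 2) ^ 2 := by gcongr
            _ = 1 / 4 := by norm_num
        have h2 := norm_sub_norm_le (1 : ℂ) (-((z - d) / (r : ℂ)) ^ 2)
        rw [norm_neg, sub_neg_eq_add, norm_one] at h2
        linarith
      rw [norm_mul] at key
      have : 3 / 4 * ‖H z‖ ≤ 2 * C / r := le_trans (by gcongr) key
      rw [le_div_iff₀ hr0] at this
      have e : 3 / 4 * ‖H z‖ * r = 3 / 8 * (‖z - c‖ * ‖H z‖) := by rw [hr]; ring
      linarith
  have hmem : Metric.ball c (ρ / 2) ∈ 𝓝 c := Metric.ball_mem_nhds _ (by positivity)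
  set K : ℂ → ℂ := fun z => (z - c) * H z with hK
  have hKd := Complex.differentiableOn_update_limUnder_of_bddAbove (f := K) hmem
    (fun z hz => by
      have : DifferentiableAt ℂ H z := (hreg z (Metric.ball_subset_ball (by linarith) hz.1)
        hz.2).analyticAt.differentiableAt
      exact (DifferentiableAt.mul (by fun_prop) this).differentiableWithinAt)
    ⟨6 * C, by rintro _ ⟨z, hz, rfl⟩; exact hbound z hz.1 hz.2⟩
  set K' := Function.update K c (limUnder (𝓝[≠] c) K) with hK'
  -- By boundedness K extends over c, and its value there is the residue. It can be read off along
  -- any approach, in particular along the horizontal ray of the hypothesis.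
  have hKc : K' c = 0 := by
    have h1 : Tendsto (fun a : ℝ => K' (c + a)) (𝓝[>] 0) (𝓝 (K' c)) := by
      have h2 : ContinuousAt K' c := (hKd.differentiableAt hmem).continuousAt
      have h3 : Tendsto (fun a : ℝ => c + (a : ℂ)) (𝓝[>] 0) (𝓝 c) := by
        have : Continuous fun a : ℝ => c + (a : ℂ) := by fun_prop
        have := this.tendsto 0
        simp only [Complex.ofReal_zero, add_zero] at this
        exact this.mono_left nhdsWithin_le_nhds
      exact h2.tendsto.comp h3
    refine tendsto_nhds_unique (h1.congr' ?_) herg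
    filter_upwards [self_mem_nhdsWithin] with a ha
    have ha' : (a : ℝ) ≠ 0 := ne_of_gt ha
    have : c + (a : ℂ) ≠ c := by simpa using ha'
    rw [hK', Function.update_of_ne this, hK]
    simp only [add_sub_cancel_left]
    rw [hG _ (by simpa [hc] using ha')]
  -- Since K' vanishes at c, dividing by z - c again stays analytic and gives back G off the axis.
  refine ⟨dslope K' c, ?_, ?_⟩
  · have := (Complex.differentiableOn_dslope hmem).2 hKd
    exact this.analyticAt hmem
  · filter_upwards with z hz
    have hzc : z ≠ c := by rintro rfl; exact hz hc
    rw [dslope_of_ne _ hzc, slope_def_module, hKc, sub_zero, hK', Function.update_of_ne hzc, hK,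
      smul_eq_mul, ← mul_assoc, inv_mul_cancel₀ (sub_ne_zero.2 hzc), one_mul, hG z hz]

/-- A function analytic off the imaginary axis, of size `O(1 / |Re z|)`, whose singularities lie
in a countable set at which the residues vanish, is zero. -/
theorem eq_zero_of_countable_singularities {G : ℂ → ℂ} {C : ℝ} (hC : 0 ≤ C)
    (hG : ∀ z, z.re ≠ 0 → DifferentiableAt ℂ G z)
    (hb : ∀ z, z.re ≠ 0 → ‖G z‖ ≤ C / |z.re|) {S : Set ℂ} (hS : S.Countable)
    (hreg : ∀ c, c.re = 0 → c ∉ S → ExtendsAt G c)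
    (herg : ∀ c ∈ S, c.re = 0 → Tendsto (fun a : ℝ => (a : ℂ) * G (c + a)) (𝓝[>] 0) (𝓝 0)) :
    ∀ z, z.re ≠ 0 → G z = 0 := by
  have hopen : IsOpen {z : ℂ | z.re ≠ 0} :=
    isOpen_compl_singleton.preimage Complex.continuous_re
  have hext : ∀ z, z.re ≠ 0 → ExtendsAt G z := fun z hz =>
    ⟨G, DifferentiableOn.analyticAt (s := {z : ℂ | z.re ≠ 0})
      (fun x hx => (hG x hx).differentiableWithinAt) (hopen.mem_nhds hz),
      Eventually.of_forall fun _ _ => rfl⟩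
  have hH : ∀ z, z.re ≠ 0 → axisExtension G z = G z := fun z hz =>
    axisExtension_eq (hG z hz).continuousAt (Eventually.of_forall fun _ _ => rfl)
  set sp : Set ℂ := {c | ExtendsAt G c}ᶜ with hsp
  have hclosed : IsClosed sp := (isOpen_extendsAt G).isClosed_compl
  have hre : ∀ c ∈ sp, c.re = 0 := fun c hc => by
    by_contra h; exact hc (hext c h)
  have hsub : sp ⊆ S := fun c hc => by
    by_contra h; exact hc (hreg c (hre c hc) h)
  have hcount : sp.Countable := hS.mono hsub
  have hempty : sp = ∅ := by
    by_contra hne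
    have hne := nonempty_iff_ne_empty.2 hne
    -- A nonempty perfect set contains a Cantor set, hence is uncountable by the diagonal argument.
    -- So the singular set has an isolated point, which turns out not to be singular.
    have hnp : ¬ Preperfect sp := fun hp => by
      obtain ⟨f, hf, -, hinj⟩ := Perfect.exists_nat_bool_injection ⟨hclosed, hp⟩ hne
      have h1 : (range f).Countable := hcount.mono hf
      have h2 : Countable (ℕ → Bool) := by
        have := h1.preimage_of_injOn (f := f) hinj.injOn
        rw [preimage_range] at this
        exact countable_univ_iff.1 this
      obtain ⟨g, hg⟩ := exists_surjective_nat (ℕ → Bool)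
      obtain ⟨k, hk⟩ := hg fun m => !(g m m)
      simpa using congrFun hk k
    rw [preperfect_iff_nhds] at hnp
    push Not at hnp
    obtain ⟨c, hc, V, hV, hVs⟩ := hnp
    obtain ⟨ρ, hρ, hball⟩ := Metric.mem_nhds_iff.1 hV
    refine hc (extendsAt_of_punctured hC hH hb (hre c hc) hρ (fun z hz hzc => ?_)
      (herg c (hsub hc) (hre c hc)))
    by_contra h
    exact hzc (hVs z ⟨hball hz, h⟩)
  have hall : ∀ z, ExtendsAt G z := fun z => by
    by_contra h
    have : z ∈ sp := h
    rw [hempty] at this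
    exact this
  intro z hz
  have hdiff : Differentiable ℂ (axisExtension G) := fun x => (hall x).analyticAt.differentiableAt
  -- The circle estimate for the now entire extension, around the projection of z to the axis: as r
  -- → ∞ the factor tends to 1 and the bound 2C/r to 0.
  have key : ∀ᶠ r : ℝ in atTop,
      ‖(1 + ((z - ⟨0, z.im⟩) / r) ^ 2) * axisExtension G z‖ ≤ 2 * C / r := by
    filter_upwards [eventually_gt_atTop 0, eventually_ge_atTop ‖z - ⟨0, z.im⟩‖] with r hr hr'
    refine norm_one_add_sq_mul_le (by simp) hr hC hdiff.diffContOnCl (fun x _ hx => ?_)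
      (mem_closedBall_iff_norm.2 hr')
    rw [hH x hx]; exact hb x hx
  have hlim : Tendsto (fun r : ℝ => ‖(1 + ((z - ⟨0, z.im⟩) / r) ^ 2) * axisExtension G z‖) atTop
      (𝓝 ‖(1 + ((z - ⟨0, z.im⟩) * 0) ^ 2) * axisExtension G z‖) := by
    have h1 : Tendsto (fun r : ℝ => ((r : ℂ))⁻¹) atTop (𝓝 0) := by
      have := (Complex.continuous_ofReal.tendsto 0).comp tendsto_inv_atTop_zero
      simpa [Function.comp_def] using this
    simp only [div_eq_mul_inv]
    exact ((((h1.const_mul _).pow 2).const_add 1).mul_const _).norm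
  have hlim2 : Tendsto (fun r : ℝ => 2 * C / r) atTop (𝓝 0) :=
    tendsto_const_nhds.div_atTop tendsto_id
  have := le_of_tendsto_of_tendsto hlim hlim2 key
  simp only [mul_zero, ne_eq, OfNat.ofNat_ne_zero, not_false_eq_true, zero_pow, add_zero,
    one_mul] at this
  rw [← hH z hz]
  exact norm_le_zero_iff.1 this

/-! ### Laplace and Carleman transforms of bounded functions -/

/-- The Laplace transform of the restriction of `U` to the half line. -/
def laplace (U : ℝ → ℂ) (z : ℂ) : ℂ := ∫ s in Ioi (0 : ℝ), Complex.exp (-(z * s)) * U s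

open Classical in
/-- The Carleman transform of a bounded function on the line. -/
def carleman (U : ℝ → ℂ) (z : ℂ) : ℂ :=
  if 0 < z.re then laplace U z else -laplace (fun s => U (-s)) (-z)

theorem norm_exp_neg_mul_ofReal (z : ℂ) (s : ℝ) :
    ‖Complex.exp (-(z * s))‖ = Real.exp (-z.re * s) := by
  rw [Complex.norm_exp]; simp

section

variable {U : ℝ → ℂ} {M : ℝ}

theorem integrableOn_laplace (hU : Continuous U) (hM : ∀ s, ‖U s‖ ≤ M) {z : ℂ} (hz : 0 < z.re) :
    IntegrableOn (fun s : ℝ => Complex.exp (-(z * s)) * U s) (Ioi 0) := by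
  refine Integrable.mono' ((integrableOn_exp_mul_Ioi (neg_lt_zero.2 hz) 0).mul_const M)
    (by fun_prop) (Eventually.of_forall fun s => ?_)
  rw [norm_mul, norm_exp_neg_mul_ofReal]
  gcongr
  exact hM s

theorem norm_laplace_le (hM : ∀ s, ‖U s‖ ≤ M) {z : ℂ} (hz : 0 < z.re) :
    ‖laplace U z‖ ≤ M / z.re := by
  have h := norm_integral_le_of_norm_le (μ := volume.restrict (Ioi (0 : ℝ)))
    (f := fun s : ℝ => Complex.exp (-(z * s)) * U s)
    ((integrableOn_exp_mul_Ioi (neg_lt_zero.2 hz) 0).mul_const M)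
    (Eventually.of_forall fun s => by
      rw [norm_mul, norm_exp_neg_mul_ofReal]
      gcongr
      exact hM s)
  refine h.trans_eq ?_
  rw [integral_mul_const, integral_exp_mul_Ioi (neg_lt_zero.2 hz)]
  simp
  field_simp

theorem differentiableAt_laplace (hU : Continuous U) (hM : ∀ s, ‖U s‖ ≤ M) {z : ℂ}
    (hz : 0 < z.re) : DifferentiableAt ℂ (laplace U) z := by
  have hM0 : 0 ≤ M := (norm_nonneg _).trans (hM 0)
  have hs : {w : ℂ | z.re / 2 < w.re} ∈ 𝓝 z :=
    (isOpen_lt continuous_const Complex.continuous_re).mem_nhds (by simp; linarith)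
  have hbi : Integrable (fun s : ℝ => 4 / z.re * M * Real.exp (-(z.re / 4) * s))
      (volume.restrict (Ioi 0)) :=
    (integrableOn_exp_mul_Ioi (by linarith) 0).const_mul _
  refine (hasDerivAt_integral_of_dominated_loc_of_deriv_le (μ := volume.restrict (Ioi (0 : ℝ)))
    (F := fun w s => Complex.exp (-(w * s)) * U s)
    (F' := fun w s => Complex.exp (-(w * s)) * (-(1 * s)) * U s) hs
    (Eventually.of_forall fun w => by fun_prop) (integrableOn_laplace hU hM hz)
    (by fun_prop) ?_ hbi ?_).2.differentiableAt
  · filter_upwards [ae_restrict_mem measurableSet_Ioi] with s hs w hw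
    have hs : 0 < s := hs
    have hw : z.re / 2 < w.re := hw
    rw [norm_mul, norm_mul, norm_exp_neg_mul_ofReal]
    have h1 : ‖-(1 * (s : ℂ))‖ = s := by simp [abs_of_pos hs]
    rw [h1]
    -- The factor s from differentiation is paid for by half of the decay rate available on the
    -- neighbourhood Re w > Re z / 2.
    have h2 : s ≤ 4 / z.re * Real.exp (z.re / 4 * s) := by
      have := Real.add_one_le_exp (z.re / 4 * s)
      rw [div_mul_eq_mul_div, le_div_iff₀ hz]
      linarith
    have h3 : Real.exp (-w.re * s) ≤ Real.exp (-(z.re / 2) * s) := by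
      apply Real.exp_le_exp.2; nlinarith
    calc Real.exp (-w.re * s) * s * ‖U s‖
        ≤ Real.exp (-(z.re / 2) * s) * (4 / z.re * Real.exp (z.re / 4 * s)) * M := by
          gcongr; exact hM s
      _ = 4 / z.re * M * (Real.exp (-(z.re / 2) * s) * Real.exp (z.re / 4 * s)) := by ring
      _ = _ := by rw [← Real.exp_add]; ring_nf
  · refine Eventually.of_forall fun s w _ => ?_
    exact (((hasDerivAt_id w).mul_const (s : ℂ)).neg.cexp).mul_const (U s)

/-- After rescaling s by a, the left side is the average of U(s/a) against e^(-s), which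
concentrates at the origin. This is how U(0) is recovered from the transform. -/
theorem tendsto_mul_laplace (hU : Continuous U) (hM : ∀ s, ‖U s‖ ≤ M) :
    Tendsto (fun a : ℝ => (a : ℂ) * laplace U a) atTop (𝓝 (U 0)) := by
  have h1 : Tendsto (fun a : ℝ => ∫ s in Ioi (0 : ℝ), Complex.exp (-(1 * s)) * U (a⁻¹ * s)) atTop
      (𝓝 (∫ s in Ioi (0 : ℝ), Complex.exp (-(1 * s)) * U 0)) := by
    refine tendsto_integral_filter_of_dominated_convergence
      (fun s => Real.exp (-1 * s) * M) (Eventually.of_forall fun a => by fun_prop)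
      (Eventually.of_forall fun a => Eventually.of_forall fun s => ?_)
      ((integrableOn_exp_mul_Ioi (by norm_num) 0).mul_const M)
      (Eventually.of_forall fun s => ?_)
    · have h := norm_exp_neg_mul_ofReal 1 s
      rw [Complex.one_re] at h
      rw [norm_mul, h]
      gcongr
      exact hM _
    · refine Tendsto.const_mul _ ?_
      have : Tendsto (fun a : ℝ => a⁻¹ * s) atTop (𝓝 (0 * s)) :=
        tendsto_inv_atTop_zero.mul_const s
      rw [zero_mul] at this
      exact (hU.tendsto 0).comp this
  have h2 : ∫ s in Ioi (0 : ℝ), Complex.exp (-(1 * s)) * U 0 = U 0 := by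
    have := integral_exp_mul_complex_Ioi (a := -1) (by simp) 0
    rw [integral_mul_const]
    simp only [one_mul, neg_mul] at this ⊢
    rw [this]; simp
  rw [h2] at h1
  refine h1.congr' ?_
  filter_upwards [eventually_gt_atTop 0] with a ha
  have h3 := integral_comp_mul_left_Ioi (fun s : ℝ => Complex.exp (-(a * s)) * U s) 0
    (inv_pos.2 ha)
  rw [mul_zero, inv_inv] at h3
  rw [laplace, ← Complex.real_smul, ← h3]
  refine integral_congr_ae (Eventually.of_forall fun s => ?_)
  have ha' : (a : ℂ) ≠ 0 := by exact_mod_cast ha.ne'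
  simp only
  push_cast
  rw [mul_inv_cancel_left₀ ha', one_mul]

theorem carleman_of_pos (U : ℝ → ℂ) {z : ℂ} (hz : 0 < z.re) : carleman U z = laplace U z :=
  if_pos hz

theorem carleman_of_neg (U : ℝ → ℂ) {z : ℂ} (hz : z.re < 0) :
    carleman U z = -laplace (fun s => U (-s)) (-z) := if_neg hz.le.not_gt

theorem norm_carleman_le (hM : ∀ s, ‖U s‖ ≤ M) {z : ℂ} (hz : z.re ≠ 0) :
    ‖carleman U z‖ ≤ M / |z.re| := by
  rcases lt_or_gt_of_ne hz with h | h
  · rw [carleman_of_neg U h, norm_neg, abs_of_neg h, ← Complex.neg_re]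
    exact norm_laplace_le (fun s => hM _) (by simpa using h)
  · rw [carleman_of_pos U h, abs_of_pos h]
    exact norm_laplace_le hM h

theorem differentiableAt_carleman (hU : Continuous U) (hM : ∀ s, ‖U s‖ ≤ M) {z : ℂ}
    (hz : z.re ≠ 0) : DifferentiableAt ℂ (carleman U) z := by
  rcases lt_or_gt_of_ne hz with h | h
  · have h1 : DifferentiableAt ℂ (fun w => -laplace (fun s => U (-s)) (-w)) z := by
      have h2 : DifferentiableAt ℂ (laplace fun s => U (-s)) (-z) :=
        differentiableAt_laplace (hU.comp continuous_neg) (fun s => hM _) (by simpa using h)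
      have h3 : DifferentiableAt ℂ (fun w : ℂ => -w) z := by fun_prop
      exact (h2.comp z h3).neg
    refine h1.congr_of_eventuallyEq ?_
    filter_upwards [(isOpen_lt Complex.continuous_re continuous_const).mem_nhds h] with w hw
    exact carleman_of_neg U hw
  · refine (differentiableAt_laplace hU hM h).congr_of_eventuallyEq ?_
    filter_upwards [(isOpen_lt continuous_const Complex.continuous_re).mem_nhds h] with w hw
    exact carleman_of_pos U hw

/-- A bounded continuous function on the line vanishes at `0` if its Carleman spectrum is
countable and its ergodic means vanish on the spectrum. -/
theorem apply_zero_eq_zero_of_countable_spectrum (hU : Continuous U) (hM : ∀ s, ‖U s‖ ≤ M)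
    {S : Set ℂ} (hS : S.Countable)
    (hreg : ∀ c, c.re = 0 → c ∉ S → ExtendsAt (carleman U) c)
    (herg : ∀ c ∈ S, c.re = 0 →
      Tendsto (fun a : ℝ => (a : ℂ) * carleman U (c + a)) (𝓝[>] 0) (𝓝 0)) : U 0 = 0 := by
  have h0 := eq_zero_of_countable_singularities ((norm_nonneg _).trans (hM 0))
    (fun z => differentiableAt_carleman hU hM) (fun z => norm_carleman_le hM) hS hreg herg
  refine tendsto_nhds_unique (tendsto_mul_laplace hU hM) (tendsto_const_nhds.congr' ?_)
  filter_upwards [eventually_gt_atTop 0] with a ha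
  have ha' : 0 < (a : ℂ).re := by simpa using ha
  rw [← carleman_of_pos U ha', h0 _ ha'.ne', mul_zero]

/-- A solution of the integrated equation that stays bounded as `s → ±∞` is the Carleman
transform. -/
theorem eq_carleman_of_bounded (hU : Continuous U) (hM : ∀ s, ‖U s‖ ≤ M) {z : ℂ}
    (hz : z.re ≠ 0) {y : ℂ} {Y : ℝ → ℂ} {B : ℝ} (hY : ∀ s, ‖Y s‖ ≤ B)
    (h : ∀ s : ℝ, y = Complex.exp (-(z * s)) * Y s
      + ∫ σ in (0 : ℝ)..s, Complex.exp (-(z * σ)) * U σ) : y = carleman U z := by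
  have hB : 0 ≤ B := (norm_nonneg _).trans (hY 0)
  -- Let s go to infinity with the sign of Re z: the boundary term e^(-zs) Y(s) dies, and the
  -- remaining integral is that branch of the Carleman transform.
  rcases lt_or_gt_of_ne hz with hz | hz
  · rw [carleman_of_neg U hz]
    have hz' : 0 < (-z).re := by simpa using hz
    have h1 : Tendsto (fun s : ℝ => ∫ σ in (0 : ℝ)..s, Complex.exp (-(-z * σ)) * U (-σ)) atTop
        (𝓝 (laplace (fun s => U (-s)) (-z))) :=
      intervalIntegral_tendsto_integral_Ioi 0
        (integrableOn_laplace (hU.comp continuous_neg) (fun s => hM _) hz') tendsto_id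
    have h2 : Tendsto (fun s : ℝ => Complex.exp (-(-z * s)) * Y (-s)) atTop (𝓝 0) := by
      refine squeeze_zero_norm (a := fun s : ℝ => Real.exp (-(-z).re * s) * B) (fun s => ?_) ?_
      · rw [norm_mul, norm_exp_neg_mul_ofReal]; gcongr; exact hY _
      · have : Tendsto (fun s : ℝ => -(-z).re * s) atTop atBot :=
          tendsto_id.const_mul_atTop_of_neg (neg_lt_zero.2 hz')
        simpa using (Real.tendsto_exp_atBot.comp this).mul_const B
    have h3 := h2.sub h1
    rw [zero_sub] at h3
    refine tendsto_nhds_unique (tendsto_const_nhds.congr fun s => ?_) h3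
    have h4 := intervalIntegral.integral_comp_neg (a := 0) (b := s)
      (fun σ : ℝ => Complex.exp (-(z * σ)) * U σ)
    rw [neg_zero, intervalIntegral.integral_symm 0 (-s)] at h4
    rw [h (-s), ← neg_neg (∫ σ in (0 : ℝ)..-s, _), ← h4]
    simp [sub_eq_add_neg]
  · rw [carleman_of_pos U hz]
    have h1 : Tendsto (fun s : ℝ => ∫ σ in (0 : ℝ)..s, Complex.exp (-(z * σ)) * U σ) atTop
        (𝓝 (laplace U z)) :=
      intervalIntegral_tendsto_integral_Ioi 0 (integrableOn_laplace hU hM hz) tendsto_id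
    have h2 : Tendsto (fun s : ℝ => Complex.exp (-(z * s)) * Y s) atTop (𝓝 0) := by
      refine squeeze_zero_norm (a := fun s : ℝ => Real.exp (-z.re * s) * B) (fun s => ?_) ?_
      · rw [norm_mul, norm_exp_neg_mul_ofReal]; gcongr; exact hY _
      · have : Tendsto (fun s : ℝ => -z.re * s) atTop atBot :=
          tendsto_id.const_mul_atTop_of_neg (neg_lt_zero.2 hz)
        simpa using (Real.tendsto_exp_atBot.comp this).mul_const B
    have h3 := h2.add h1
    rw [zero_add] at h3
    exact tendsto_nhds_unique (tendsto_const_nhds.congr fun s => h s) h3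

end

/-! ### Bounded functions on the half line and their shifts -/

section

variable {X : Type*} [NormedAddCommGroup X]

/-- The translation `t ↦ max (t + s) 0` of the half line. -/
def shiftMap (s : ℝ) : C(ℝ≥0, ℝ≥0) := ⟨fun t => ((t : ℝ) + s).toNNReal, by fun_prop⟩

/-- The translate of a bounded function, extended by its value at `0` to the negative axis. -/
def shift (s : ℝ) (h : ℝ≥0 →ᵇ X) : ℝ≥0 →ᵇ X := h.compContinuous (shiftMap s)

theorem shift_apply (s : ℝ) (h : ℝ≥0 →ᵇ X) (t : ℝ≥0) :
    shift s h t = h ((t : ℝ) + s).toNNReal := rfl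

theorem norm_shift_le (s : ℝ) (h : ℝ≥0 →ᵇ X) : ‖shift s h‖ ≤ ‖h‖ :=
  (BoundedContinuousFunction.norm_le (norm_nonneg _)).2 fun _ => h.norm_coe_le_norm _

theorem continuous_shift {h : ℝ≥0 →ᵇ X} (hh : UniformContinuous h) :
    Continuous fun s => shift s h := by
  rw [Metric.continuous_iff]
  intro s ε hε
  obtain ⟨δ, hδ, H⟩ := Metric.uniformContinuous_iff.1 hh (ε / 2) (by positivity)
  refine ⟨δ, hδ, fun s' hs' => ?_⟩
  refine lt_of_le_of_lt ((BoundedContinuousFunction.dist_le (by positivity)).2 fun t => ?_)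
    (half_lt_self hε)
  refine (H ?_).le
  refine lt_of_le_of_lt ?_ hs'
  change |max ((t : ℝ) + s') 0 - max ((t : ℝ) + s) 0| ≤ |s' - s|
  refine (abs_max_sub_max_le_abs _ _ _).trans (le_of_eq ?_)
  congr 1; ring

variable [NormedSpace ℂ X]

/-- A functional that annihilates the functions vanishing at infinity maps a bounded solution of
`y' = z y - v + e`, where `e` vanishes at infinity, to the Carleman transform of
`s ↦ φ (shift s v)`. -/
theorem apply_eq_carleman [CompleteSpace X] {φ : (ℝ≥0 →ᵇ X) →L[ℂ] ℂ}
    (hφ : ∀ h : ℝ≥0 →ᵇ X, Tendsto h atTop (𝓝 0) → φ h = 0) {v y : ℝ≥0 →ᵇ X}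
    (hv : UniformContinuous v) {z : ℂ} (hz : z.re ≠ 0) {e : ℝ → X}
    (he : ContinuousOn e (Ioi 0)) (he0 : Tendsto e atTop (𝓝 0))
    (hy : ∀ t : ℝ, 0 < t → HasDerivAt (fun s : ℝ => y s.toNNReal)
      (z • y t.toNNReal - v t.toNNReal + e t) t) :
    φ y = carleman (fun s => φ (shift s v)) z := by
  have hcont := continuous_shift hv
  refine eq_carleman_of_bounded (M := ‖φ‖ * ‖v‖) (B := ‖φ‖ * ‖y‖)
    (Y := fun s => φ (shift s y)) (by fun_prop)
    (fun s => (φ.le_opNorm _).trans (by gcongr; exact norm_shift_le s v)) hz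
    (fun s => (φ.le_opNorm _).trans (by gcongr; exact norm_shift_le s y)) fun s => ?_
  have hcont' : Continuous fun σ : ℝ => Complex.exp (-(z * σ)) • shift σ v := by fun_prop
  set J : ℝ≥0 →ᵇ X := ∫ σ in (0 : ℝ)..s, Complex.exp (-(z * σ)) • shift σ v with hJ
  have hφJ : φ J = ∫ σ in (0 : ℝ)..s, Complex.exp (-(z * σ)) * φ (shift σ v) := by
    rw [hJ, ← φ.intervalIntegral_comp_comm (hcont'.intervalIntegrable _ _)]
    simp
  have hJt : ∀ t : ℝ≥0, J t = ∫ σ in (0 : ℝ)..s,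
      Complex.exp (-(z * σ)) • v ((t : ℝ) + σ).toNNReal := fun t => by
    have := (BoundedContinuousFunction.evalCLM ℂ t).intervalIntegral_comp_comm
      (hcont'.intervalIntegrable (μ := volume) 0 s) (F := X)
    simpa [shift_apply] using this.symm
  -- The formula y = e^(-zs) · (translate of y by s) + J fails only by a function vanishing at
  -- infinity, which φ does not see. That is what has to be checked.
  rw [← hφJ, ← smul_eq_mul, ← map_smul, ← map_add, ← sub_eq_zero, ← map_sub]
  refine hφ _ ?_
  rw [Metric.tendsto_nhds]
  intro ε hε
  -- The error is an integral of e^(-zσ) e(t + σ) over an interval of length |s|, on which the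
  -- exponential is at most exp(‖z‖|s|).
  set δ : ℝ := ε / (2 * (Real.exp (‖z‖ * |s|) * (|s| + 1))) with hδ
  have hδ0 : 0 < δ := by positivity
  obtain ⟨N, hN⟩ := eventually_atTop.1 (Metric.tendsto_nhds.1 he0 δ hδ0)
  -- For such t the whole segment from t to t + s lies in the open half line and beyond N, so the
  -- truncation at the origin plays no role and e is small.
  filter_upwards [eventually_ge_atTop (Real.toNNReal (max N 0 + |s| + 1))] with t ht
  have ht' : max N 0 + |s| + 1 ≤ (t : ℝ) := by
    have := NNReal.coe_le_coe.2 ht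
    rwa [Real.coe_toNNReal _ (by positivity)] at this
  have hσ : ∀ σ ∈ uIcc 0 s, N ≤ t + σ ∧ 0 < (t : ℝ) + σ ∧ |σ| ≤ |s| := by
    intro σ hσ
    have h1 : |σ| ≤ |s| := by simpa using abs_sub_left_of_mem_uIcc hσ
    have h2 := neg_abs_le σ
    have h3 := le_max_left N 0
    have h4 := le_max_right N 0
    exact ⟨by linarith, by linarith, h1⟩
  have hee : ContinuousOn (fun σ : ℝ => Complex.exp (-(z * σ)) • e (t + σ)) (uIcc 0 s) := by
    refine ContinuousOn.smul (by fun_prop) (he.comp (by fun_prop) fun σ h => (hσ σ h).2.1)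
  have hvv : Continuous fun σ : ℝ => Complex.exp (-(z * σ)) • v ((t : ℝ) + σ).toNNReal := by
    fun_prop
  have hFTC : ∫ σ in (0 : ℝ)..s, (Complex.exp (-(z * σ)) • e (t + σ)
        - Complex.exp (-(z * σ)) • v ((t : ℝ) + σ).toNNReal)
      = Complex.exp (-(z * s)) • y ((t : ℝ) + s).toNNReal - y t := by
    have := intervalIntegral.integral_eq_sub_of_hasDerivAt (a := 0) (b := s)
      (f := fun σ : ℝ => Complex.exp (-(z * σ)) • y ((t : ℝ) + σ).toNNReal)
      (f' := fun σ : ℝ => Complex.exp (-(z * σ)) • e (t + σ)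
        - Complex.exp (-(z * σ)) • v ((t : ℝ) + σ).toNNReal) (fun σ h => ?_)
      (hee.intervalIntegrable.sub (hvv.intervalIntegrable _ _))
    · simpa using this
    · have h1 : HasDerivAt (fun σ : ℝ => Complex.exp (-(z * σ)))
          (Complex.exp (-(z * σ)) * (-(z * 1))) σ :=
        ((Complex.ofRealCLM.hasDerivAt (x := σ)).const_mul z).neg.cexp
      have h2 := (hy (t + σ) (hσ σ h).2.1).comp_const_add (t : ℝ) σ
      refine (h1.smul h2).congr_deriv ?_
      simp only [smul_add, smul_sub, smul_smul, mul_one, mul_neg, neg_smul]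
      abel
  rw [intervalIntegral.integral_sub hee.intervalIntegrable (hvv.intervalIntegrable _ _),
    ← hJt] at hFTC
  have heq : (y - (Complex.exp (-(z * s)) • shift s y + J)) t
      = -∫ σ in (0 : ℝ)..s, Complex.exp (-(z * σ)) • e (t + σ) := by
    simp only [BoundedContinuousFunction.coe_sub, Pi.sub_apply, BoundedContinuousFunction.coe_add,
      Pi.add_apply, BoundedContinuousFunction.coe_smul, shift_apply]
    rw [sub_eq_sub_iff_add_eq_add] at hFTC
    rw [← sub_eq_zero, ← sub_eq_zero.2 hFTC]
    abel
  rw [dist_zero_right, heq, norm_neg]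
  have hbd : ‖∫ σ in (0 : ℝ)..s, Complex.exp (-(z * σ)) • e (t + σ)‖
      ≤ Real.exp (‖z‖ * |s|) * δ * |s - 0| := by
    refine intervalIntegral.norm_integral_le_of_norm_le_const fun σ h => ?_
    obtain ⟨h1, h2, h3⟩ := hσ σ (uIoc_subset_uIcc h)
    rw [norm_smul]
    gcongr
    · rw [Complex.norm_exp]
      refine Real.exp_le_exp.2 ((Complex.re_le_norm _).trans ?_)
      rw [norm_neg, norm_mul, Complex.norm_real, Real.norm_eq_abs]
      gcongr
    · simpa using (hN _ h1).le
  refine hbd.trans_lt ?_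
  have h1 : Real.exp (‖z‖ * |s|) * δ * (|s| + 1) = ε / 2 := by rw [hδ]; field_simp
  have h2 : Real.exp (‖z‖ * |s|) * δ * |s - 0| ≤ Real.exp (‖z‖ * |s|) * δ * (|s| + 1) := by
    gcongr; rw [sub_zero]; linarith
  linarith

/-! ### The weight -/

variable {n : ℕ}

theorem norm_le_norm_mul_pow (h : BUC n X) (t : ℝ≥0) : ‖h t‖ ≤ ‖h‖ * (1 + (t : ℝ)) ^ n := by
  have h2 : 0 < (1 + (t : ℝ)) ^ n := by positivity
  exact (div_le_iff₀ h2).1 (le_bucNorm h t)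

theorem norm_le_of_forall_norm_le {h : BUC n X} {C : ℝ}
    (hC : ∀ t : ℝ≥0, ‖h t‖ ≤ C * (1 + (t : ℝ)) ^ n) : ‖h‖ ≤ C :=
  ciSup_le fun t => by
    have h2 : 0 < (1 + (t : ℝ)) ^ n := by positivity
    exact (div_le_iff₀ h2).2 (hC t)

theorem BUC.continuous_coe (h : BUC n X) : Continuous fun t => h t := h.2.2.1

theorem continuous_inv_pow (n : ℕ) : Continuous fun t : ℝ≥0 => ((1 + (t : ℝ)) ^ n)⁻¹ :=
  Continuous.inv₀ (by fun_prop) fun t => by positivity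

/-- The bounded function `t ↦ (1 + t)^(-n) h(t)`, for `h` continuous of growth `O((1 + t)^n)`. -/
def weightedOf (n : ℕ) (h : ℝ≥0 → X) (hc : Continuous h) (C : ℝ)
    (hC : ∀ t : ℝ≥0, ‖h t‖ ≤ C * (1 + (t : ℝ)) ^ n) : ℝ≥0 →ᵇ X :=
  BoundedContinuousFunction.ofNormedAddCommGroup (fun t => ((1 + (t : ℝ)) ^ n)⁻¹ • h t)
    ((continuous_inv_pow n).smul hc) C fun t => by
      have h2 : 0 < (1 + (t : ℝ)) ^ n := by positivity
      rw [norm_smul, Real.norm_of_nonneg (by positivity), inv_mul_le_iff₀ h2, mul_comm]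
      exact hC t

theorem weightedOf_apply {h : ℝ≥0 → X} {hc : Continuous h} {C : ℝ}
    {hC : ∀ t : ℝ≥0, ‖h t‖ ≤ C * (1 + (t : ℝ)) ^ n} (t : ℝ≥0) :
    weightedOf n h hc C hC t = ((1 + (t : ℝ)) ^ n)⁻¹ • h t := rfl

theorem norm_weightedOf_le {h : ℝ≥0 → X} {hc : Continuous h} {C : ℝ}
    {hC : ∀ t : ℝ≥0, ‖h t‖ ≤ C * (1 + (t : ℝ)) ^ n} : ‖weightedOf n h hc C hC‖ ≤ C := by
  have hC0 : 0 ≤ C := by simpa using (norm_nonneg _).trans (hC 0)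
  refine (BoundedContinuousFunction.norm_le hC0).2 fun t => ?_
  have h2 : 0 < (1 + (t : ℝ)) ^ n := by positivity
  rw [weightedOf_apply, norm_smul, Real.norm_of_nonneg (by positivity), inv_mul_le_iff₀ h2,
    mul_comm]
  exact hC t

/-- The isometry `h ↦ (1 + t)^(-n) h` of `BUC_n` into the bounded functions. -/
def weighted (h : BUC n X) : ℝ≥0 →ᵇ X :=
  weightedOf n h h.continuous_coe ‖h‖ (norm_le_norm_mul_pow h)

theorem weighted_apply (h : BUC n X) (t : ℝ≥0) :
    weighted h t = ((1 + (t : ℝ)) ^ n)⁻¹ • h t := rfl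

theorem norm_weighted_le (h : BUC n X) : ‖weighted h‖ ≤ ‖h‖ := norm_weightedOf_le

theorem weighted_smul (c : ℂ) (h : BUC n X) : weighted (c • h) = c • weighted h := by
  ext t
  simp only [weighted_apply, BUC.coe_smul, BoundedContinuousFunction.coe_smul]
  rw [smul_comm]

/-- The increment splits into the weighted increment of h, controlled by the definition of BUC_n,
and a change of weight. The latter is relatively at most (1+s)^n - 1, uniformly in t, because 1 + t
+ s ≤ (1+t)(1+s). -/
theorem uniformContinuous_weighted (h : BUC n X) : UniformContinuous (weighted h) := by
  rw [Metric.uniformContinuous_iff]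
  intro ε hε
  obtain ⟨δ₁, hδ₁, H⟩ := h.2.2.2 (ε / 2) (by positivity)
  have hlim : Tendsto (fun s : ℝ≥0 => ‖h‖ * ((1 + (s : ℝ)) ^ n - 1)) (𝓝 0) (𝓝 0) := by
    have : Continuous fun s : ℝ≥0 => ‖h‖ * ((1 + (s : ℝ)) ^ n - 1) := by fun_prop
    simpa using this.tendsto 0
  obtain ⟨δ₂, hδ₂, H₂⟩ := Metric.eventually_nhds_iff.1
    (hlim.eventually (gt_mem_nhds (half_pos hε)))
  have main : ∀ t s : ℝ≥0, s < δ₁ → (s : ℝ) < δ₂ →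
      dist (weighted h (t + s)) (weighted h t) < ε := by
    intro t s hs1 hs2
    rcases eq_or_ne s 0 with rfl | hs
    · simpa using hε
    have h1 := H s (pos_iff_ne_zero.2 hs) hs1 t
    have h2 := H₂ (y := s) (by simpa [NNReal.dist_eq] using hs2)
    have hp : 0 < (1 + (t : ℝ)) ^ n := by positivity
    have hq : 0 < (1 + ((t + s : ℝ≥0) : ℝ)) ^ n := by positivity
    have h3 : (1 + ((t + s : ℝ≥0) : ℝ)) ^ n ≤ (1 + (t : ℝ)) ^ n * (1 + (s : ℝ)) ^ n := by
      rw [← mul_pow]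
      gcongr
      rw [NNReal.coe_add]
      nlinarith [mul_nonneg t.2 s.2, t.2, s.2]
    have h4 : ((1 + (t : ℝ)) ^ n)⁻¹ - ((1 + ((t + s : ℝ≥0) : ℝ)) ^ n)⁻¹
        ≤ ((1 + (s : ℝ)) ^ n - 1) * ((1 + ((t + s : ℝ≥0) : ℝ)) ^ n)⁻¹ := by
      rw [sub_mul, one_mul]
      refine sub_le_sub_right ?_ _
      rw [← div_eq_mul_inv, le_div_iff₀ hq, inv_mul_le_iff₀ hp]
      exact h3
    have h5 : 0 ≤ ((1 + (t : ℝ)) ^ n)⁻¹ - ((1 + ((t + s : ℝ≥0) : ℝ)) ^ n)⁻¹ := by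
      rw [sub_nonneg]
      gcongr
      linarith [s.2]
    have e : weighted h (t + s) - weighted h t = ((1 + (t : ℝ)) ^ n)⁻¹ • (h (t + s) - h t)
        - (((1 + (t : ℝ)) ^ n)⁻¹ - ((1 + ((t + s : ℝ≥0) : ℝ)) ^ n)⁻¹) • h (t + s) := by
      rw [weighted_apply, weighted_apply, smul_sub, sub_smul]
      abel
    rw [dist_eq_norm, e]
    refine lt_of_le_of_lt (norm_sub_le _ _) ?_
    rw [norm_smul, norm_smul, Real.norm_of_nonneg h5, Real.norm_of_nonneg (by positivity),
      ← div_eq_inv_mul]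
    have h6 : (((1 + (t : ℝ)) ^ n)⁻¹ - ((1 + ((t + s : ℝ≥0) : ℝ)) ^ n)⁻¹) * ‖h (t + s)‖
        ≤ ‖h‖ * ((1 + (s : ℝ)) ^ n - 1) := by
      calc _ ≤ (((1 + (s : ℝ)) ^ n - 1) * ((1 + ((t + s : ℝ≥0) : ℝ)) ^ n)⁻¹)
              * (‖h‖ * (1 + ((t + s : ℝ≥0) : ℝ)) ^ n) :=
            mul_le_mul h4 (norm_le_norm_mul_pow h _) (norm_nonneg _) (h5.trans h4)
        _ = _ := by field_simp
    linarith
  refine ⟨min δ₁ δ₂, lt_min hδ₁ hδ₂, fun {a b} hab => ?_⟩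
  rw [lt_min_iff] at hab
  rcases le_total a b with hle | hle
  · obtain ⟨s, rfl⟩ := exists_add_of_le hle
    have hd : dist a (a + s) = s := by
      rw [NNReal.dist_eq]; push_cast; rw [sub_add_cancel_left, abs_neg]; exact abs_of_nonneg s.2
    rw [hd] at hab
    rw [dist_comm]
    exact main a s (by exact_mod_cast hab.1) hab.2
  · obtain ⟨s, rfl⟩ := exists_add_of_le hle
    have hd : dist (b + s) b = s := by
      rw [NNReal.dist_eq]; push_cast; rw [add_sub_cancel_left]; exact abs_of_nonneg s.2
    rw [hd] at hab
    exact main b s (by exact_mod_cast hab.1) hab.2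

/-- The form of `apply_eq_carleman` in which the equation `y' = z y - u + e` holds before
multiplication by the weight. -/
theorem apply_eq_carleman_weighted [CompleteSpace X] {φ : (ℝ≥0 →ᵇ X) →L[ℂ] ℂ}
    (hφ : ∀ h : ℝ≥0 →ᵇ X, Tendsto h atTop (𝓝 0) → φ h = 0) (u : BUC n X)
    {z : ℂ} (hz : z.re ≠ 0) {y : ℝ → X} {w : ℝ≥0 →ᵇ X}
    (hw : ∀ t : ℝ≥0, w t = ((1 + (t : ℝ)) ^ n)⁻¹ • y t) {e : ℝ → X}
    (he : ContinuousOn e (Ioi 0))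
    (he0 : Tendsto (fun t : ℝ => ((1 + t) ^ n)⁻¹ • e t) atTop (𝓝 0))
    (hy : ∀ t : ℝ, 0 < t → HasDerivAt y (z • y t - u t.toNNReal + e t) t) :
    φ w = carleman (fun s => φ (shift s (weighted u))) z := by
  have hw' : ∀ t : ℝ, 0 < t → w t.toNNReal = ((1 + t) ^ n)⁻¹ • y t := fun t ht => by
    rw [hw, Real.coe_toNNReal _ ht.le]
  -- Differentiating the weight produces -n/(1+t) times the bounded function w, which vanishes at
  -- infinity and so joins the error term.
  refine apply_eq_carleman hφ (uniformContinuous_weighted u) hz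
    (e := fun t => ((1 + t) ^ n)⁻¹ • e t - (n * (1 + t)⁻¹) • w t.toNNReal) ?_ ?_ fun t ht => ?_
  · have h1 : ∀ t ∈ Ioi (0 : ℝ), (1 + t) ≠ 0 := fun t (ht : 0 < t) => by positivity
    have h2 : ContinuousOn (fun t : ℝ => ((1 + t) ^ n)⁻¹) (Ioi 0) :=
      ContinuousOn.inv₀ (by fun_prop) fun t ht => pow_ne_zero n (h1 t ht)
    have h3 : ContinuousOn (fun t : ℝ => n * (1 + t)⁻¹) (Ioi 0) :=
      continuousOn_const.mul (ContinuousOn.inv₀ (by fun_prop) h1)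
    have h4 : Continuous fun t : ℝ => w t.toNNReal := by fun_prop
    exact (h2.smul he).sub (h3.smul h4.continuousOn)
  · rw [← sub_zero (0 : X)]
    refine he0.sub ?_
    refine squeeze_zero_norm' (a := fun t : ℝ => n * (1 + t)⁻¹ * ‖w‖) ?_ ?_
    · filter_upwards [eventually_gt_atTop 0] with t ht
      rw [norm_smul, Real.norm_of_nonneg (by positivity)]
      gcongr
      exact w.norm_coe_le_norm _
    · have : Tendsto (fun t : ℝ => (1 + t)⁻¹) atTop (𝓝 0) :=
        tendsto_inv_atTop_zero.comp (tendsto_atTop_add_const_left _ _ tendsto_id)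
      simpa using (this.const_mul (n : ℝ)).mul_const ‖w‖
  · have ht1 : 1 + t ≠ 0 := by positivity
    have h1 : HasDerivAt (fun s : ℝ => ((1 + s) ^ n)⁻¹)
        (-((n * (1 + t)⁻¹) * ((1 + t) ^ n)⁻¹)) t := by
      have h2 := (((hasDerivAt_id t).const_add 1).pow n).inv (pow_ne_zero n ht1)
      refine h2.congr_deriv ?_
      rcases n with _ | m
      · simp
      · simp only [id, Nat.add_sub_cancel, mul_one, Pi.pow_apply]
        field_simp
        ring
    refine ((h1.smul (hy t ht)).congr_deriv ?_).congr_of_eventuallyEq ?_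
    · rw [hw' t ht, weighted_apply, Real.coe_toNNReal _ ht.le]
      simp only [smul_add, smul_sub, neg_smul, smul_smul]
      rw [smul_comm z]
      abel
    · filter_upwards [eventually_gt_nhds ht] with s hs
      exact hw' s hs

end

/-! ### The resolvent of the differentiation operator -/

section

variable {X : Type*} [NormedAddCommGroup X] [NormedSpace ℂ X] {n : ℕ}

theorem integrableOn_pow_mul_exp (n : ℕ) {a : ℝ} (ha : 0 < a) :
    IntegrableOn (fun s : ℝ => Real.exp (-a * s) * (1 + s) ^ n) (Ioi 0) := by
  refine Integrable.mono' ((integrableOn_exp_mul_Ioi (a := -(a / 2)) (by linarith) 0).const_mul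
    (n.factorial * (2 / a) ^ n * Real.exp (a / 2))) (by fun_prop) ?_
  filter_upwards [ae_restrict_mem measurableSet_Ioi] with s hs
  have hs : 0 < s := hs
  rw [Real.norm_of_nonneg (by positivity)]
  have h1 := Real.pow_div_factorial_le_exp (x := a / 2 * (1 + s)) (by positivity) n
  rw [div_le_iff₀ (by positivity)] at h1
  have h2 : (1 + s) ^ n = (2 / a) ^ n * (a / 2 * (1 + s)) ^ n := by
    rw [← mul_pow]; congr 1; field_simp
  calc Real.exp (-a * s) * (1 + s) ^ n
      ≤ Real.exp (-a * s) * ((2 / a) ^ n * (Real.exp (a / 2 * (1 + s)) * n.factorial)) := by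
        rw [h2]; gcongr
    _ = n.factorial * (2 / a) ^ n * (Real.exp (-a * s) * Real.exp (a / 2 * (1 + s))) := by ring
    _ = n.factorial * (2 / a) ^ n * (Real.exp (a / 2) * Real.exp (-(a / 2) * s)) := by
        rw [← Real.exp_add, ← Real.exp_add]; ring_nf
    _ = _ := by ring

theorem tendsto_exp_mul_pow (n : ℕ) {a : ℝ} (ha : 0 < a) :
    Tendsto (fun s : ℝ => Real.exp (-a * s) * (1 + s) ^ n) atTop (𝓝 0) := by
  have h1 := Real.tendsto_pow_mul_exp_neg_atTop_nhds_zero n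
  have h2 : Tendsto (fun s : ℝ => a * (1 + s)) atTop atTop :=
    (tendsto_atTop_add_const_left _ _ tendsto_id).const_mul_atTop ha
  have h3 := ((h1.comp h2).const_mul (Real.exp a * a⁻¹ ^ n))
  rw [mul_zero] at h3
  refine h3.congr fun s => ?_
  simp only [Function.comp]
  calc Real.exp a * a⁻¹ ^ n * ((a * (1 + s)) ^ n * Real.exp (-(a * (1 + s))))
      = (a⁻¹ * a) ^ n * (Real.exp a * Real.exp (-(a * (1 + s)))) * (1 + s) ^ n := by
        rw [mul_pow, mul_pow]; ring
    _ = _ := by rw [← Real.exp_add, inv_mul_cancel₀ ha.ne', one_pow]; ring_nf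

/-- Submultiplicativity of the weight: a translation by s costs only (1+s)^n uniformly in t, which
the exponential of the Laplace integral absorbs. -/
theorem one_add_add_pow_le (t : ℝ≥0) {s : ℝ} (hs : 0 ≤ s) :
    (1 + ((t : ℝ) + s)) ^ n ≤ (1 + (t : ℝ)) ^ n * (1 + s) ^ n := by
  rw [← mul_pow]
  have := t.2
  gcongr
  nlinarith [mul_nonneg t.2 hs]

theorem norm_shifted_le {Y : Type*} [NormedAddCommGroup Y] {h : ℝ≥0 → Y} {C : ℝ}
    (hC : ∀ t : ℝ≥0, ‖h t‖ ≤ C * (1 + (t : ℝ)) ^ n)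
    (t : ℝ≥0) {s : ℝ} (hs : 0 ≤ s) :
    ‖h ((t : ℝ) + s).toNNReal‖ ≤ C * (1 + (t : ℝ)) ^ n * (1 + s) ^ n := by
  have hC0 : 0 ≤ C := by simpa using (norm_nonneg _).trans (hC 0)
  have h1 := hC ((t : ℝ) + s).toNNReal
  rw [Real.coe_toNNReal _ (by positivity)] at h1
  refine h1.trans ?_
  rw [mul_assoc]
  gcongr
  exact one_add_add_pow_le t hs

/-- The vector-valued Laplace transform of the translate of `h` by `t`. -/
def shiftLaplace (z : ℂ) (h : ℝ≥0 → X) (t : ℝ≥0) : X :=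
  ∫ s in Ioi (0 : ℝ), Complex.exp (-(z * s)) • h ((t : ℝ) + s).toNNReal

section

variable {z : ℂ} {h : ℝ≥0 → X} {C : ℝ}

theorem norm_shiftLaplace_integrand_le (hC : ∀ t : ℝ≥0, ‖h t‖ ≤ C * (1 + (t : ℝ)) ^ n) (t : ℝ≥0) :
    ∀ᵐ s : ℝ ∂volume.restrict (Ioi 0), ‖Complex.exp (-(z * s)) • h ((t : ℝ) + s).toNNReal‖
      ≤ C * (1 + (t : ℝ)) ^ n * (Real.exp (-z.re * s) * (1 + s) ^ n) := by
  filter_upwards [ae_restrict_mem measurableSet_Ioi] with s hs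
  rw [norm_smul, norm_exp_neg_mul_ofReal]
  calc _ ≤ Real.exp (-z.re * s) * (C * (1 + (t : ℝ)) ^ n * (1 + s) ^ n) := by
        gcongr; exact norm_shifted_le hC t (le_of_lt hs)
    _ = _ := by ring

theorem norm_shiftLaplace_le (hz : 0 < z.re)
    (hC : ∀ t : ℝ≥0, ‖h t‖ ≤ C * (1 + (t : ℝ)) ^ n) (t : ℝ≥0) :
    ‖shiftLaplace z h t‖
      ≤ C * (1 + (t : ℝ)) ^ n * ∫ s in Ioi (0 : ℝ), Real.exp (-z.re * s) * (1 + s) ^ n := by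
  rw [← integral_const_mul]
  exact norm_integral_le_of_norm_le ((integrableOn_pow_mul_exp n hz).const_mul _)
    (norm_shiftLaplace_integrand_le hC t)

theorem integrableOn_shiftLaplace (hz : 0 < z.re) (hc : Continuous h)
    (hC : ∀ t : ℝ≥0, ‖h t‖ ≤ C * (1 + (t : ℝ)) ^ n) (t : ℝ≥0) :
    IntegrableOn (fun s : ℝ => Complex.exp (-(z * s)) • h ((t : ℝ) + s).toNNReal) (Ioi 0) := by
  have : Continuous fun s : ℝ => Complex.exp (-(z * s)) • h ((t : ℝ) + s).toNNReal := by fun_prop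
  exact Integrable.mono' ((integrableOn_pow_mul_exp n hz).const_mul _)
    this.aestronglyMeasurable (norm_shiftLaplace_integrand_le hC t)

/-- Substituting τ = t + s moves t out of the argument of h into an exponential and a limit of
integration, so that differentiating in t needs only continuity of h. -/
theorem shiftLaplace_eq (hz : 0 < z.re) (hc : Continuous h)
    (hC : ∀ t : ℝ≥0, ‖h t‖ ≤ C * (1 + (t : ℝ)) ^ n) (t : ℝ≥0) :
    shiftLaplace z h t = Complex.exp (z * (t : ℝ)) • (shiftLaplace z h 0
      - ∫ τ in (0 : ℝ)..t, Complex.exp (-(z * τ)) • h τ.toNNReal) := by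
  set F : ℝ → X := fun τ => Complex.exp (-(z * τ)) • h τ.toNNReal with hF
  have h0 : IntegrableOn F (Ioi 0) := by
    simpa using integrableOn_shiftLaplace hz hc hC 0
  have h1 : IntegrableOn F (Ioi (t : ℝ)) := h0.mono_set (Ioi_subset_Ioi t.2)
  have h2 : shiftLaplace z h 0 = ∫ τ in Ioi (0 : ℝ), F τ := by simp [shiftLaplace, hF]
  have h3 : ∫ τ in (0 : ℝ)..t, F τ = (∫ τ in Ioi (0 : ℝ), F τ) - ∫ τ in Ioi (t : ℝ), F τ := by
    rw [eq_sub_iff_add_eq]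
    exact intervalIntegral.integral_interval_add_Ioi h0 h1
  rw [h2, h3, sub_sub_cancel]
  have h4 := (measurePreserving_add_left volume (t : ℝ)).setIntegral_preimage_emb
    (measurableEmbedding_addLeft (t : ℝ)) F (Ioi (t : ℝ))
  rw [preimage_const_add_Ioi, sub_self] at h4
  rw [← h4, shiftLaplace, ← integral_smul]
  refine integral_congr_ae (Eventually.of_forall fun s => ?_)
  simp only [hF, smul_smul, ← Complex.exp_add]
  congr 2
  push_cast
  ring

theorem hasDerivAt_shiftLaplace (hz : 0 < z.re) [CompleteSpace X] (hc : Continuous h)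
    (hC : ∀ t : ℝ≥0, ‖h t‖ ≤ C * (1 + (t : ℝ)) ^ n) (t : ℝ≥0) :
    HasDerivWithinAt (fun s : ℝ => shiftLaplace z h s.toNNReal) (z • shiftLaplace z h t - h t)
      (Ici 0) (t : ℝ) := by
  set F : ℝ → X := fun τ => Complex.exp (-(z * τ)) • h τ.toNNReal with hF
  have hFc : Continuous F := by fun_prop
  have h1 : HasDerivAt (fun s : ℝ => Complex.exp (z * s)) (Complex.exp (z * (t : ℝ)) * (z * 1))
      (t : ℝ) := ((Complex.ofRealCLM.hasDerivAt (x := (t : ℝ))).const_mul z).cexp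
  have h2 := (hFc.integral_hasStrictDerivAt 0 (t : ℝ)).hasDerivAt.const_sub (shiftLaplace z h 0)
  refine (h1.smul h2).hasDerivWithinAt.congr_deriv ?_ |>.congr ?_ ?_
  · rw [shiftLaplace_eq hz hc hC t]
    simp only [hF, Real.toNNReal_coe, smul_neg, smul_smul, ← Complex.exp_add, add_neg_cancel,
      Complex.exp_zero, one_smul, mul_one]
    rw [mul_comm _ z, neg_add_eq_sub]
  · intro s hs
    rw [shiftLaplace_eq hz hc hC, Real.coe_toNNReal _ hs]
    rfl
  · simp only [Real.toNNReal_coe]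
    rw [shiftLaplace_eq hz hc hC]
    rfl

end

theorem continuous_of_hasDerivWithinAt {g g' : ℝ≥0 → X}
    (hg : ∀ t : ℝ≥0, HasDerivWithinAt (fun s : ℝ => g s.toNNReal) (g' t) (Ici 0) (t : ℝ)) :
    Continuous g := by
  rw [continuous_iff_continuousAt]
  intro t
  have h1 : ContinuousWithinAt (fun s : ℝ => g s.toNNReal) (Ici 0) (t : ℝ) :=
    (hg t).continuousWithinAt
  have h2 : Tendsto (fun s : ℝ≥0 => (s : ℝ)) (𝓝 t) (𝓝[Ici 0] (t : ℝ)) :=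
    tendsto_nhdsWithin_iff.2 ⟨NNReal.continuous_coe.tendsto t, Eventually.of_forall fun s => s.2⟩
  have h3 := h1.tendsto.comp h2
  simpa [Function.comp_def, ContinuousAt] using h3

/-- Eigenfunctions are multiples of e^(zt), which outgrows (1+t)^n. This injectivity of z - 𝒟 yields
both linearity of the candidate resolvent and the left inverse property. -/
theorem eq_zero_of_mem_diffGraph {z : ℂ} (hz : 0 < z.re) {d : BUC n X}
    (hd : (d, z • d) ∈ diffGraph n X) : d = 0 := by
  have hconst : ∀ b : ℝ, 0 ≤ b → Complex.exp (-(z * b)) • d b.toNNReal = d 0 := by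
    intro b hb
    have h0 : ∀ x ∈ Icc (0 : ℝ) b, HasDerivWithinAt
        (fun s : ℝ => Complex.exp (-(z * s)) • d s.toNNReal) 0 (Ici 0) x := by
      intro x hx
      have h1 : HasDerivAt (fun σ : ℝ => Complex.exp (-(z * σ)))
          (Complex.exp (-(z * x)) * (-(z * 1))) x :=
        ((Complex.ofRealCLM.hasDerivAt (x := x)).const_mul z).neg.cexp
      have h2 := hd ⟨x, hx.1⟩
      refine (h1.hasDerivWithinAt.smul h2).congr_deriv ?_
      have e : x.toNNReal = ⟨x, hx.1⟩ := Real.toNNReal_of_nonneg hx.1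
      rw [e]
      change _ • z • d _ + _ • d _ = _
      rw [smul_smul, ← add_smul]
      convert zero_smul ℂ _
      simp
    have := constant_of_has_deriv_right_zero
      (fun x hx => ((h0 x hx).continuousWithinAt).mono Icc_subset_Ici_self)
      (fun x hx => (h0 x ⟨hx.1, hx.2.le⟩).mono (Ici_subset_Ici.2 hx.1)) b ⟨hb, le_rfl⟩
    simpa using this
  have hzero : d 0 = 0 := by
    refine tendsto_nhds_unique (f := fun b : ℝ => Complex.exp (-(z * b)) • d b.toNNReal)
      (l := atTop) (tendsto_const_nhds.congr' ?_) ?_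
    · filter_upwards [eventually_ge_atTop 0] with b hb using (hconst b hb).symm
    · refine squeeze_zero_norm' (a := fun b : ℝ => ‖d‖ * (Real.exp (-z.re * b) * (1 + b) ^ n)) ?_
        (by simpa using (tendsto_exp_mul_pow n hz).const_mul ‖d‖)
      filter_upwards [eventually_ge_atTop 0] with b hb
      have h1 := norm_le_norm_mul_pow d b.toNNReal
      rw [Real.coe_toNNReal _ hb] at h1
      rw [norm_smul, norm_exp_neg_mul_ofReal]
      calc _ ≤ Real.exp (-z.re * b) * (‖d‖ * (1 + b) ^ n) := by gcongr
        _ = _ := by ring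
  refine BUC.ext fun t => ?_
  have h1 := hconst t t.2
  rw [hzero, Real.toNNReal_coe, smul_eq_zero] at h1
  exact h1.resolve_left (Complex.exp_ne_zero _)

variable [CompleteSpace X]

/-- The candidate for the resolvent of `d/dt` at `z`, applied to `h`. -/
def diffResolventFun {z : ℂ} (hz : 0 < z.re) (h : BUC n X) : BUC n X :=
  ⟨shiftLaplace z h, by
    constructor
    · refine ⟨‖h‖ * ∫ s in Ioi (0 : ℝ), Real.exp (-z.re * s) * (1 + s) ^ n, ?_⟩
      rintro _ ⟨t, rfl⟩
      have hp : 0 < (1 + (t : ℝ)) ^ n := by positivity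
      rw [div_le_iff₀ hp]
      refine (norm_shiftLaplace_le hz (norm_le_norm_mul_pow h) t).trans (le_of_eq (by ring))
    · refine ⟨continuous_of_hasDerivWithinAt
        (hasDerivAt_shiftLaplace hz h.continuous_coe (norm_le_norm_mul_pow h)), fun ε hε => ?_⟩
      set κ : ℝ := ∫ s in Ioi (0 : ℝ), Real.exp (-z.re * s) * (1 + s) ^ n
      have hκ : 0 ≤ κ := setIntegral_nonneg measurableSet_Ioi fun s (hs : 0 < s) => by positivity
      obtain ⟨δ, hδ, H⟩ := h.2.2.2 (ε / (κ + 1)) (by positivity)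
      refine ⟨δ, hδ, fun s hs hsδ t => ?_⟩
      -- The transform commutes with translation, so its increment is the transform of the increment
      -- of h, at the cost of the factor κ. Dividing by κ + 1 keeps the denominator positive.
      have hC : ∀ r : ℝ≥0, ‖h (r + s) - h r‖ ≤ ε / (κ + 1) * (1 + (r : ℝ)) ^ n := fun r => by
        have hp : 0 < (1 + (r : ℝ)) ^ n := by positivity
        exact (div_le_iff₀ hp).1 (H s hs hsδ r)
      have hp : 0 < (1 + (t : ℝ)) ^ n := by positivity
      rw [div_le_iff₀ hp]
      have e : shiftLaplace z h (t + s) - shiftLaplace z h t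
          = shiftLaplace z (fun r => h (r + s) - h r) t := by
        rw [shiftLaplace, shiftLaplace, ← integral_sub
          (integrableOn_shiftLaplace hz h.continuous_coe (norm_le_norm_mul_pow h) _)
          (integrableOn_shiftLaplace hz h.continuous_coe (norm_le_norm_mul_pow h) _)]
        refine setIntegral_congr_fun measurableSet_Ioi fun r (hr : 0 < r) => ?_
        have : ((t : ℝ) + r).toNNReal + s = (((t + s : ℝ≥0) : ℝ) + r).toNNReal := by
          rw [← NNReal.coe_inj, NNReal.coe_add, Real.coe_toNNReal _ (by positivity),
            Real.coe_toNNReal _ (by positivity), NNReal.coe_add]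
          ring
        simp only [this, smul_sub]
      rw [e]
      refine (norm_shiftLaplace_le hz hC t).trans ?_
      calc ε / (κ + 1) * (1 + (t : ℝ)) ^ n * κ ≤ ε / (κ + 1) * (1 + (t : ℝ)) ^ n * (κ + 1) := by
            gcongr; linarith
        _ = ε * (1 + (t : ℝ)) ^ n := by field_simp⟩

theorem diffResolventFun_mem {z : ℂ} (hz : 0 < z.re) (h : BUC n X) :
    (diffResolventFun hz h, z • diffResolventFun hz h - h) ∈ diffGraph n X :=
  hasDerivAt_shiftLaplace hz h.continuous_coe (norm_le_norm_mul_pow h)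

/-- The resolvent of `d/dt` at `z`, `Re z > 0`. -/
def diffResolvent {z : ℂ} (hz : 0 < z.re) : BUC n X →L[ℂ] BUC n X :=
  LinearMap.mkContinuous
    { toFun := diffResolventFun hz
      map_add' := fun f g => by
        rw [← sub_eq_zero]
        refine eq_zero_of_mem_diffGraph hz ?_
        have h := Submodule.sub_mem _ (diffResolventFun_mem hz (f + g))
          (Submodule.add_mem _ (diffResolventFun_mem hz f) (diffResolventFun_mem hz g))
        convert h using 1
        simp only [Prod.mk_add_mk, Prod.mk_sub_mk, Prod.mk.injEq, true_and]
        rw [smul_sub, smul_add]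
        abel
      map_smul' := fun c f => by
        rw [← sub_eq_zero]
        refine eq_zero_of_mem_diffGraph hz ?_
        have h := Submodule.sub_mem _ (diffResolventFun_mem hz (c • f))
          (Submodule.smul_mem _ c (diffResolventFun_mem hz f))
        convert h using 1
        simp only [Prod.smul_mk, Prod.mk_sub_mk, Prod.mk.injEq, RingHom.id_apply, true_and]
        rw [smul_sub, smul_sub, smul_comm z c]
        abel }
    (∫ s in Ioi (0 : ℝ), Real.exp (-z.re * s) * (1 + s) ^ n) fun h =>
      norm_le_of_forall_norm_le fun t =>
        (norm_shiftLaplace_le hz (norm_le_norm_mul_pow h) t).trans (le_of_eq (by ring))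

theorem isResolvent_diffResolvent {z : ℂ} (hz : 0 < z.re) :
    IsResolvent (diffOp n X) z (diffResolvent hz) := by
  have hR : ∀ h, diffResolvent (n := n) (X := X) hz h = diffResolventFun hz h := fun _ => rfl
  constructor
  · intro h
    have hmem : (diffResolvent hz h, z • diffResolvent hz h - h) ∈ (diffOp n X).graph := by
      rw [diffOp_graph]; exact diffResolventFun_mem hz h
    have hdom := LinearPMap.mem_domain_iff.2 ⟨_, hmem⟩
    refine ⟨hdom, ?_⟩
    rw [← (LinearPMap.image_iff hdom).2 hmem, sub_sub_cancel]
  · intro x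
    have hx : ((x : BUC n X), diffOp n X x) ∈ diffGraph n X := by
      rw [← diffOp_graph]; exact (diffOp n X).mem_graph x
    rw [← sub_eq_zero]
    refine eq_zero_of_mem_diffGraph hz ?_
    have h := Submodule.sub_mem _ (diffResolventFun_mem hz (z • (x : BUC n X) - diffOp n X x)) hx
    convert h using 1
    simp only [Prod.mk_sub_mk, Prod.mk.injEq, hR, true_and]
    rw [smul_sub]
    abel

theorem resolventOp_mem_diffGraph {z : ℂ} (hz : 0 < z.re) (h : BUC n X) :
    (resolventOp (diffOp n X) z h, z • resolventOp (diffOp n X) z h - h) ∈ diffGraph n X := by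
  rw [(isResolvent_diffResolvent hz).resolventOp_eq]
  exact diffResolventFun_mem hz h

/-- The resolvent solves y' = z y - u with no error term. This translates the ergodicity hypothesis,
stated for 𝒟 on BUC_n, into a residue condition on the scalar Carleman transform. -/
theorem apply_weighted_resolventOp {φ : (ℝ≥0 →ᵇ X) →L[ℂ] ℂ}
    (hφ : ∀ h : ℝ≥0 →ᵇ X, Tendsto h atTop (𝓝 0) → φ h = 0) (u : BUC n X)
    {z : ℂ} (hz : 0 < z.re) :
    φ (weighted (resolventOp (diffOp n X) z u))
      = carleman (fun s => φ (shift s (weighted u))) z := by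
  refine apply_eq_carleman_weighted hφ u hz.ne' (e := 0)
    (y := fun s => resolventOp (diffOp n X) z u s.toNNReal) (fun t => ?_) continuousOn_const
    (by simp) fun t ht => ?_
  · rw [weighted_apply, Real.toNNReal_coe]
  · have h1 := (resolventOp_mem_diffGraph hz u) ⟨t, ht.le⟩
    have h2 := h1.hasDerivAt (Ici_mem_nhds ht)
    have e : t.toNNReal = ⟨t, ht.le⟩ := Real.toNNReal_of_nonneg ht.le
    rw [e, Pi.zero_apply, add_zero]
    exact h2

theorem tendsto_mul_carleman {φ : (ℝ≥0 →ᵇ X) →L[ℂ] ℂ}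
    (hφ : ∀ h : ℝ≥0 →ᵇ X, Tendsto h atTop (𝓝 0) → φ h = 0) {u : BUC n X} {η : ℝ}
    (h : HasErgodicMean η u 0) :
    Tendsto (fun a : ℝ => (a : ℂ) * carleman (fun s => φ (shift s (weighted u)))
      (Complex.I * η + a)) (𝓝[>] 0) (𝓝 0) := by
  have h1 := tendsto_zero_iff_norm_tendsto_zero.1 h
  refine squeeze_zero_norm' (a := fun a : ℝ => ‖φ‖ * _) ?_ (by simpa using h1.const_mul ‖φ‖)
  filter_upwards [self_mem_nhdsWithin] with a ha
  have ha : 0 < a := ha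
  have hre : 0 < (Complex.I * η + a : ℂ).re := by simpa using ha
  rw [← apply_weighted_resolventOp hφ u hre, ← smul_eq_mul, ← map_smul, ← weighted_smul,
    add_comm]
  exact (φ.le_opNorm _).trans (by gcongr; exact norm_weighted_le _)

end

/-! ### Stieltjes transforms and the integral representation of powers -/

/-- At 0 this needs α - 1 > -1, and at infinity the integrand is of order r^(α-2) with α - 2 < -1.
It controls both the scalar density r^(α-1) and the vector-valued `expConvDensity`. -/
theorem integrableOn_rpow_div {α : ℝ} (hα0 : 0 < α) (hα1 : α < 1) :
    IntegrableOn (fun r : ℝ => r ^ (α - 1) / (1 + r)) (Ioi 0) := by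
  rw [← Ioc_union_Ioi_eq_Ioi (zero_le_one' ℝ)]
  refine IntegrableOn.union ?_ ?_
  · have h1 : IntegrableOn (fun r : ℝ => r ^ (α - 1)) (Ioc 0 1) :=
      (intervalIntegral.intervalIntegrable_rpow' (by linarith)).1
    refine Integrable.mono' h1 (Measurable.aestronglyMeasurable (by fun_prop)) ?_
    filter_upwards [ae_restrict_mem measurableSet_Ioc] with r hr
    have hr0 : 0 < r := hr.1
    rw [Real.norm_of_nonneg (by positivity)]
    exact div_le_self (by positivity) (by linarith)
  · have h1 : IntegrableOn (fun r : ℝ => r ^ (α - 2)) (Ioi 1) :=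
      integrableOn_Ioi_rpow_of_lt (by linarith) one_pos
    refine Integrable.mono' h1 (Measurable.aestronglyMeasurable (by fun_prop)) ?_
    filter_upwards [ae_restrict_mem measurableSet_Ioi] with r hr
    have hr0 : (0 : ℝ) < r := one_pos.trans hr
    rw [Real.norm_of_nonneg (by positivity), div_le_iff₀ (by positivity)]
    have : r ^ (α - 1) = r ^ (α - 2) * r := by
      rw [← Real.rpow_add_one hr0.ne']; congr 1; ring
    rw [this]
    gcongr
    linarith

/-- The point -z is off the ray [0, ∞), and ‖r + z‖ grows like r. Uniformity near z gives the
domination for differentiating Stieltjes transforms under the integral. -/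
theorem exists_mul_one_add_le_norm_add {z : ℂ} (hz : z ∈ Complex.slitPlane) :
    ∃ δ > 0, ∀ w ∈ Metric.ball z δ, ∀ r : ℝ, 0 ≤ r → δ * (1 + r) ≤ ‖(r : ℂ) + w‖ := by
  -- Twice the constant is obtained at z itself, because moving z by δ loses at most δ ≤ δ(1 + r).
  obtain ⟨δ, hδ, H⟩ : ∃ δ > 0, ∀ r : ℝ, 0 ≤ r → 2 * δ * (1 + r) ≤ ‖(r : ℂ) + z‖ := by
    rcases hz with hz | hz
    · refine ⟨min 1 z.re / 2, by positivity, fun r hr => ?_⟩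
      refine le_trans ?_ (Complex.re_le_norm _)
      simp only [Complex.add_re, Complex.ofReal_re]
      have h1 := min_le_left 1 z.re
      have h2 := min_le_right 1 z.re
      nlinarith
    · have hz' : 0 < |z.im| := abs_pos.2 hz
      refine ⟨min (1 / 4) (|z.im| / (4 * (1 + ‖z‖))), by positivity, fun r hr => ?_⟩
      have hz0 := norm_nonneg z
      by_cases h : 2 * ‖z‖ + 1 ≤ r
      · have h1 : r - ‖z‖ ≤ ‖(r : ℂ) + z‖ := by
          have := norm_sub_norm_le (r : ℂ) (-z)
          rwa [norm_neg, sub_neg_eq_add, Complex.norm_real, Real.norm_of_nonneg hr] at this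
        have h2 := min_le_left (1 / 4) (|z.im| / (4 * (1 + ‖z‖)))
        calc _ ≤ 2 * (1 / 4) * (1 + r) := by gcongr
          _ ≤ r - ‖z‖ := by linarith
          _ ≤ _ := h1
      · push Not at h
        have h1 : |z.im| ≤ ‖(r : ℂ) + z‖ := by
          simpa using Complex.abs_im_le_norm ((r : ℂ) + z)
        have h2 := min_le_right (1 / 4) (|z.im| / (4 * (1 + ‖z‖)))
        calc _ ≤ 2 * (|z.im| / (4 * (1 + ‖z‖))) * (2 * (1 + ‖z‖)) := by gcongr; linarith
          _ = |z.im| := by field_simp; norm_num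
          _ ≤ _ := h1
  refine ⟨δ, hδ, fun w hw r hr => ?_⟩
  have h1 := H r hr
  have h2 := norm_sub_norm_le ((r : ℂ) + z) (z - w)
  rw [mem_ball_iff_norm, norm_sub_rev] at hw
  have h3 : (r : ℂ) + z - (z - w) = r + w := by ring
  rw [h3] at h2
  nlinarith

section

variable {E : Type*} [NormedAddCommGroup E] [NormedSpace ℂ E] {e : ℝ → E}

/-- The Stieltjes transform of a density on the half line. -/
def stieltjes (e : ℝ → E) (z : ℂ) : E := ∫ r in Ioi (0 : ℝ), ((r : ℂ) + z)⁻¹ • e r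

theorem aestronglyMeasurable_stieltjes (he : AEStronglyMeasurable e (volume.restrict (Ioi 0)))
    (z : ℂ) : AEStronglyMeasurable (fun r : ℝ => ((r : ℂ) + z)⁻¹ • e r)
      (volume.restrict (Ioi 0)) := by
  have h : Measurable fun r : ℝ => ((r : ℂ) + z)⁻¹ := by fun_prop
  exact h.aestronglyMeasurable.smul he

theorem integrableOn_stieltjes (he : AEStronglyMeasurable e (volume.restrict (Ioi 0)))
    (hi : IntegrableOn (fun r : ℝ => ‖e r‖ / (1 + r)) (Ioi 0)) {z : ℂ}
    (hz : z ∈ Complex.slitPlane) :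
    IntegrableOn (fun r : ℝ => ((r : ℂ) + z)⁻¹ • e r) (Ioi 0) := by
  obtain ⟨δ, hδ, H⟩ := exists_mul_one_add_le_norm_add hz
  refine Integrable.mono' (hi.const_mul δ⁻¹) (aestronglyMeasurable_stieltjes he z) ?_
  filter_upwards [ae_restrict_mem measurableSet_Ioi] with r hr
  have hr : 0 < r := hr
  have h1 := H z (Metric.mem_ball_self hδ) r hr.le
  rw [norm_smul, norm_inv]
  calc ‖(r : ℂ) + z‖⁻¹ * ‖e r‖ ≤ (δ * (1 + r))⁻¹ * ‖e r‖ := by gcongr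
    _ = δ⁻¹ * (‖e r‖ / (1 + r)) := by field_simp

theorem differentiableAt_stieltjes (he : AEStronglyMeasurable e (volume.restrict (Ioi 0)))
    (hi : IntegrableOn (fun r : ℝ => ‖e r‖ / (1 + r)) (Ioi 0)) {z : ℂ}
    (hz : z ∈ Complex.slitPlane) : DifferentiableAt ℂ (stieltjes e) z := by
  obtain ⟨δ, hδ, H⟩ := exists_mul_one_add_le_norm_add hz
  refine (hasDerivAt_integral_of_dominated_loc_of_deriv_le (μ := volume.restrict (Ioi (0 : ℝ)))
    (F := fun w (r : ℝ) => ((r : ℂ) + w)⁻¹ • e r)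
    (F' := fun w (r : ℝ) => (-1 / ((r : ℂ) + w) ^ 2) • e r)
    (bound := fun r : ℝ => (δ ^ 2)⁻¹ * (‖e r‖ / (1 + r)))
    (Metric.ball_mem_nhds z hδ)
    (Eventually.of_forall fun w => aestronglyMeasurable_stieltjes he w)
    (integrableOn_stieltjes he hi hz) ?_ ?_ (hi.const_mul _) ?_).2.differentiableAt
  · have h : Measurable fun r : ℝ => -1 / ((r : ℂ) + z) ^ 2 := by fun_prop
    exact h.aestronglyMeasurable.smul he
  · filter_upwards [ae_restrict_mem measurableSet_Ioi] with r hr w hw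
    have hr : 0 < r := hr
    have h1 := H w hw r hr.le
    have h2 : δ ^ 2 * (1 + r) ≤ ‖(r : ℂ) + w‖ ^ 2 := by
      calc δ ^ 2 * (1 + r) ≤ δ ^ 2 * (1 + r) * (1 + r) := by
            apply le_mul_of_one_le_right (by positivity); linarith
        _ = (δ * (1 + r)) ^ 2 := by ring
        _ ≤ _ := by gcongr
    rw [norm_smul, norm_div, norm_neg, norm_one, norm_pow, one_div]
    calc (‖(r : ℂ) + w‖ ^ 2)⁻¹ * ‖e r‖ ≤ (δ ^ 2 * (1 + r))⁻¹ * ‖e r‖ := by gcongr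
      _ = (δ ^ 2)⁻¹ * (‖e r‖ / (1 + r)) := by field_simp
  · filter_upwards [ae_restrict_mem measurableSet_Ioi] with r hr w hw
    have hr : 0 < r := hr
    have h1 := H w hw r hr.le
    have h0 : (r : ℂ) + w ≠ 0 := norm_pos_iff.1 (lt_of_lt_of_le (by positivity) h1)
    exact (((hasDerivAt_id w).const_add (r : ℂ)).inv h0).smul_const (e r)

end

/-- Writing 1/(r+x) as the integral of e^(-(r+x)t) and swapping the order leaves two Gamma
integrals. -/
theorem integral_rpow_div_add {α : ℝ} (hα0 : 0 < α) (hα1 : α < 1) {x : ℝ} (hx : 0 < x) :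
    ∫ r in Ioi (0 : ℝ), (r + x)⁻¹ * r ^ (α - 1)
      = Real.Gamma α * Real.Gamma (1 - α) * x ^ (α - 1) := by
  have hinner : ∀ r ∈ Ioi (0 : ℝ), ∫ t in Ioi (0 : ℝ), r ^ (α - 1) * Real.exp (-(r + x) * t)
      = (r + x)⁻¹ * r ^ (α - 1) := by
    intro r hr
    have hr : 0 < r := hr
    rw [integral_const_mul, integral_exp_mul_Ioi (by linarith)]
    simp only [mul_zero, Real.exp_zero]
    rw [neg_div_neg_eq, one_div, mul_comm]
  have hx1 : 0 < min 1 x := lt_min one_pos hx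
  have hint : IntegrableOn (fun r : ℝ => (r + x)⁻¹ * r ^ (α - 1)) (Ioi 0) := by
    refine Integrable.mono' ((integrableOn_rpow_div hα0 hα1).const_mul (min 1 x)⁻¹)
      (by fun_prop) ?_
    filter_upwards [ae_restrict_mem measurableSet_Ioi] with r hr
    have hr : 0 < r := hr
    rw [Real.norm_of_nonneg (by positivity)]
    calc (r + x)⁻¹ * r ^ (α - 1) ≤ (min 1 x * (1 + r))⁻¹ * r ^ (α - 1) := by
          gcongr
          have h1 := min_le_left 1 x
          have h2 := min_le_right 1 x
          nlinarith
      _ = _ := by rw [mul_inv]; ring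
  have hprod : Integrable (Function.uncurry fun r t : ℝ => r ^ (α - 1) * Real.exp (-(r + x) * t))
      ((volume.restrict (Ioi 0)).prod (volume.restrict (Ioi 0))) := by
    rw [integrable_prod_iff (by fun_prop)]
    constructor
    · filter_upwards [ae_restrict_mem measurableSet_Ioi] with r hr
      have hr : 0 < r := hr
      exact (integrableOn_exp_mul_Ioi (neg_lt_zero.2 (add_pos hr hx)) 0).const_mul (r ^ (α - 1))
    · refine hint.congr ?_
      filter_upwards [ae_restrict_mem measurableSet_Ioi] with r hr
      rw [← hinner r hr]
      refine setIntegral_congr_fun measurableSet_Ioi fun t (ht : 0 < t) => ?_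
      have hr : 0 < r := hr
      simp only [Function.uncurry]
      rw [Real.norm_of_nonneg (by positivity)]
  calc ∫ r in Ioi (0 : ℝ), (r + x)⁻¹ * r ^ (α - 1)
      = ∫ r in Ioi (0 : ℝ), ∫ t in Ioi (0 : ℝ), r ^ (α - 1) * Real.exp (-(r + x) * t) :=
        setIntegral_congr_fun measurableSet_Ioi fun r hr => (hinner r hr).symm
    _ = ∫ t in Ioi (0 : ℝ), ∫ r in Ioi (0 : ℝ), r ^ (α - 1) * Real.exp (-(r + x) * t) :=
        integral_integral_swap hprod
    _ = ∫ t in Ioi (0 : ℝ), Real.Gamma α * (t ^ ((1 - α) - 1) * Real.exp (-(x * t))) := by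
        refine setIntegral_congr_fun measurableSet_Ioi fun t (ht : 0 < t) => ?_
        have h1 := Real.integral_rpow_mul_exp_neg_mul_Ioi hα0 ht
        have h2 : (1 / t) ^ α = t ^ ((1 - α) - 1) := by
          rw [one_div, Real.inv_rpow ht.le, ← Real.rpow_neg ht.le]; congr 1; ring
        rw [← h2, ← mul_assoc, mul_comm (Real.Gamma α), ← h1, ← integral_mul_const]
        refine setIntegral_congr_fun measurableSet_Ioi fun r _ => ?_
        rw [mul_assoc, ← Real.exp_add]
        ring_nf
    _ = _ := by
        rw [integral_const_mul, Real.integral_rpow_mul_exp_neg_mul_Ioi (by linarith) hx]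
        have : (1 / x) ^ (1 - α) = x ^ (α - 1) := by
          rw [one_div, Real.inv_rpow hx.le, ← Real.rpow_neg hx.le]; congr 1; ring
        rw [this]; ring

/-- The Stieltjes transform of a power. -/
theorem stieltjes_rpow {α : ℝ} (hα0 : 0 < α) (hα1 : α < 1) {z : ℂ} (hz : z ∈ Complex.slitPlane) :
    stieltjes (fun r : ℝ => ((r ^ (α - 1) : ℝ) : ℂ)) z
      = (Real.Gamma α * Real.Gamma (1 - α) : ℝ) * z ^ ((α : ℂ) - 1) := by
  have hm : AEStronglyMeasurable (fun r : ℝ => ((r ^ (α - 1) : ℝ) : ℂ))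
      (volume.restrict (Ioi 0)) := by
    have : Measurable fun r : ℝ => ((r ^ (α - 1) : ℝ) : ℂ) := by fun_prop
    exact this.aestronglyMeasurable
  have hi : IntegrableOn (fun r : ℝ => ‖((r ^ (α - 1) : ℝ) : ℂ)‖ / (1 + r)) (Ioi 0) := by
    refine (integrableOn_rpow_div hα0 hα1).congr_fun (fun r (hr : 0 < r) => ?_) measurableSet_Ioi
    simp only
    rw [Complex.norm_real, Real.norm_of_nonneg (by positivity)]
  have h1 : AnalyticOnNhd ℂ (stieltjes fun r : ℝ => ((r ^ (α - 1) : ℝ) : ℂ)) Complex.slitPlane :=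
    DifferentiableOn.analyticOnNhd
      (fun w hw => (differentiableAt_stieltjes hm hi hw).differentiableWithinAt)
      Complex.isOpen_slitPlane
  have h2 : AnalyticOnNhd ℂ
      (fun z : ℂ => (Real.Gamma α * Real.Gamma (1 - α) : ℝ) * z ^ ((α : ℂ) - 1))
      Complex.slitPlane :=
    DifferentiableOn.analyticOnNhd
      (fun w hw => ((differentiableAt_id.cpow_const hw).const_mul _).differentiableWithinAt)
      Complex.isOpen_slitPlane
  -- Both sides are analytic on the connected slit plane and agree on the positive reals, which
  -- accumulate at 1.
  refine AnalyticOnNhd.eqOn_of_preconnected_of_frequently_eq h1 h2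
    (Complex.starConvex_one_slitPlane.isPathConnected
      Complex.one_mem_slitPlane).isConnected.isPreconnected Complex.one_mem_slitPlane ?_ hz
  have hreal : ∀ x : ℝ, 0 < x → stieltjes (fun r : ℝ => ((r ^ (α - 1) : ℝ) : ℂ)) x
      = (Real.Gamma α * Real.Gamma (1 - α) : ℝ) * (x : ℂ) ^ ((α : ℂ) - 1) := by
    intro x hx
    have h := congrArg (fun y : ℝ => (y : ℂ)) (integral_rpow_div_add hα0 hα1 hx)
    rw [← integral_complex_ofReal, Complex.ofReal_mul _ (x ^ (α - 1)),
      Complex.ofReal_cpow hx.le] at h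
    push_cast at h ⊢
    rw [← h]
    rfl
  have hlim : Tendsto (fun x : ℝ => (x : ℂ)) (𝓝[≠] 1) (𝓝[≠] 1) := by
    refine tendsto_nhdsWithin_iff.2 ⟨?_, ?_⟩
    · exact (Complex.continuous_ofReal.tendsto' 1 1 (by simp)).mono_left nhdsWithin_le_nhds
    · filter_upwards [self_mem_nhdsWithin] with x hx
      simpa using hx
  refine hlim.frequently (Eventually.frequently ?_)
  filter_upwards [nhdsWithin_le_nhds (eventually_gt_nhds one_pos)] with x hx
  exact hreal x hx

/-! ### Exponential convolutions -/

section

variable {X : Type*} [NormedAddCommGroup X] [NormedSpace ℂ X] {n : ℕ}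

/-- The convolution of `u` with `e^(-r t)` on the half line. -/
def expConv (r : ℝ) (u : ℝ≥0 → X) (t : ℝ≥0) : X :=
  ∫ τ in (0 : ℝ)..t, Real.exp (-(r * (t - τ))) • u τ.toNNReal

theorem expConv_eq (r : ℝ) (u : ℝ≥0 → X) (t : ℝ≥0) :
    expConv r u t = Real.exp (-(r * t)) • ∫ τ in (0 : ℝ)..t, Real.exp (r * τ) • u τ.toNNReal := by
  rw [expConv, ← intervalIntegral.integral_smul]
  refine intervalIntegral.integral_congr fun τ _ => ?_
  simp only [smul_smul, ← Real.exp_add]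
  congr 2; ring

theorem integral_exp_neg_mul_sub_le {m t : ℝ} (hm : 0 < m) :
    ∫ τ in (0 : ℝ)..t, Real.exp (-(m * (t - τ))) ≤ 1 / m := by
  have h : ∀ τ ∈ uIcc 0 t, HasDerivAt (fun τ : ℝ => Real.exp (-(m * (t - τ))) / m)
      (Real.exp (-(m * (t - τ)))) τ := fun τ _ => by
    have h1 := ((((hasDerivAt_id τ).const_sub t).const_mul m).neg.exp).div_const m
    refine h1.congr_deriv ?_
    simp only [id, Pi.neg_apply]
    field_simp
  rw [intervalIntegral.integral_eq_sub_of_hasDerivAt h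
    (Continuous.intervalIntegrable (by fun_prop) _ _), ← sub_div]
  gcongr
  simp [Real.exp_nonneg]

/-- The difference of the exponentials brings down t - τ, absorbed by half of the decay. The bound
depends on t only through B, so after weighting r ↦ e^(-rt) * u is continuous in sup norm, as the
measurability of the density requires. -/
theorem norm_expConv_sub_le {r r' m : ℝ} (hm : 0 < m) (hr : m ≤ r) (hr' : m ≤ r')
    {u : ℝ≥0 → X} (hu : Continuous u) {t : ℝ≥0} {B : ℝ} (hB : ∀ τ ≤ t, ‖u τ‖ ≤ B) :
    ‖expConv r u t - expConv r' u t‖ ≤ 4 / m ^ 2 * |r - r'| * B := by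
  have hc : ∀ r : ℝ, IntervalIntegrable
      (fun τ : ℝ => Real.exp (-(r * (t - τ))) • u τ.toNNReal) volume 0 t := fun r =>
    Continuous.intervalIntegrable (by fun_prop) _ _
  have hB0 : 0 ≤ B := (norm_nonneg _).trans (hB 0 t.2)
  rw [expConv, expConv, ← intervalIntegral.integral_sub (hc r) (hc r')]
  have hbd : ∀ τ ∈ Ioc (0 : ℝ) t, ‖Real.exp (-(r * (t - τ))) • u τ.toNNReal
      - Real.exp (-(r' * (t - τ))) • u τ.toNNReal‖
      ≤ |r - r'| * (2 / m) * B * Real.exp (-(m / 2 * (t - τ))) := by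
    intro τ hτ
    have hs : 0 ≤ (t : ℝ) - τ := by linarith [hτ.2]
    have h1 : ∀ a b : ℝ, m ≤ a → a ≤ b →
        |Real.exp (-(a * (t - τ))) - Real.exp (-(b * (t - τ)))|
          ≤ (b - a) * (2 / m) * Real.exp (-(m / 2) * (t - τ)) := by
      intro a b ha hab
      have e1 : Real.exp (-(b * (t - τ)))
          = Real.exp (-(a * (t - τ))) * Real.exp (-((b - a) * (t - τ))) := by
        rw [← Real.exp_add]; ring_nf
      have e2 := Real.add_one_le_exp (-((b - a) * (t - τ)))
      have e3 := Real.add_one_le_exp (m / 2 * (t - τ))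
      have e4 : Real.exp (-(a * (t - τ))) ≤ Real.exp (-(m * (t - τ))) := by
        apply Real.exp_le_exp.2; nlinarith
      have e5 : Real.exp (-((b - a) * (t - τ))) ≤ 1 := by
        apply Real.exp_le_one_iff.2; nlinarith
      have e6 : t - τ ≤ 2 / m * Real.exp (m / 2 * (t - τ)) := by
        rw [div_mul_eq_mul_div, le_div_iff₀ hm]; linarith
      rw [e1, ← mul_one_sub, abs_of_nonneg (mul_nonneg (Real.exp_nonneg _) (by linarith))]
      calc Real.exp (-(a * (t - τ))) * (1 - Real.exp (-((b - a) * (t - τ))))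
          ≤ Real.exp (-(m * (t - τ))) * ((b - a) * (t - τ)) := by
            apply mul_le_mul e4 (by linarith) (by linarith) (Real.exp_nonneg _)
        _ ≤ Real.exp (-(m * (t - τ))) * ((b - a) * (2 / m * Real.exp (m / 2 * (t - τ)))) := by
            gcongr
        _ = (b - a) * (2 / m) * (Real.exp (-(m * (t - τ))) * Real.exp (m / 2 * (t - τ))) := by
            ring
        _ = _ := by rw [← Real.exp_add]; ring_nf
    have h2 : |Real.exp (-(r * (t - τ))) - Real.exp (-(r' * (t - τ)))|
          ≤ |r - r'| * (2 / m) * Real.exp (-(m / 2) * (t - τ)) := by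
      rcases le_total r r' with h | h
      · rw [abs_sub_comm r r', abs_of_nonneg (sub_nonneg.2 h)]; exact h1 r r' hr h
      · rw [abs_of_nonneg (sub_nonneg.2 h), abs_sub_comm]; exact h1 r' r hr' h
    rw [← sub_smul, norm_smul, Real.norm_eq_abs]
    have h3 : ‖u τ.toNNReal‖ ≤ B := hB _ (Real.toNNReal_le_iff_le_coe.2 hτ.2)
    calc _ ≤ |r - r'| * (2 / m) * Real.exp (-(m / 2) * (t - τ)) * B := by gcongr
      _ = _ := by rw [neg_mul]; ring
  refine (intervalIntegral.norm_integral_le_of_norm_le t.coe_nonneg (ae_of_all _ hbd)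
    (Continuous.intervalIntegrable (by fun_prop) _ _)).trans ?_
  rw [intervalIntegral.integral_const_mul]
  calc |r - r'| * (2 / m) * B * ∫ τ in (0 : ℝ)..t, Real.exp (-(m / 2 * (t - τ)))
      ≤ |r - r'| * (2 / m) * B * (1 / (m / 2)) := by
        gcongr; exact integral_exp_neg_mul_sub_le (by positivity)
    _ = 4 / m ^ 2 * |r - r'| * B := by field_simp; ring

theorem norm_expConv_le {r : ℝ} (hr : 0 < r) {u : ℝ≥0 → X} {t : ℝ≥0} {B : ℝ}
    (hB : ∀ τ ≤ t, ‖u τ‖ ≤ B) : ‖expConv r u t‖ ≤ B / r := by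
  have hB0 : 0 ≤ B := (norm_nonneg _).trans (hB 0 t.2)
  have hbd : ∀ τ ∈ Ioc (0 : ℝ) t, ‖Real.exp (-(r * (t - τ))) • u τ.toNNReal‖
      ≤ B * Real.exp (-(r * (t - τ))) := fun τ hτ => by
    rw [norm_smul, Real.norm_of_nonneg (Real.exp_nonneg _), mul_comm]
    gcongr
    exact hB _ (Real.toNNReal_le_iff_le_coe.2 hτ.2)
  refine (intervalIntegral.norm_integral_le_of_norm_le t.coe_nonneg (ae_of_all _ hbd)
    (Continuous.intervalIntegrable (by fun_prop) _ _)).trans ?_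
  rw [intervalIntegral.integral_const_mul, div_eq_mul_one_div]
  gcongr
  exact integral_exp_neg_mul_sub_le hr

section

variable [CompleteSpace X] {u : ℝ≥0 → X}

theorem hasDerivAt_expConv (r : ℝ) (hu : Continuous u) (s : ℝ) :
    HasDerivAt (fun s : ℝ => Real.exp (-(r * s)) • ∫ τ in (0 : ℝ)..s,
        Real.exp (r * τ) • u τ.toNNReal)
      (u s.toNNReal - r • Real.exp (-(r * s)) • ∫ τ in (0 : ℝ)..s,
        Real.exp (r * τ) • u τ.toNNReal) s := by
  have hF : Continuous fun τ : ℝ => Real.exp (r * τ) • u τ.toNNReal := by fun_prop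
  have h1 : HasDerivAt (fun s : ℝ => Real.exp (-(r * s))) (Real.exp (-(r * s)) * (-(r * 1))) s :=
    ((hasDerivAt_id s).const_mul r).neg.exp
  refine (h1.smul (hF.integral_hasStrictDerivAt 0 s).hasDerivAt).congr_deriv ?_
  rw [smul_smul, smul_smul, ← Real.exp_add, neg_add_cancel, Real.exp_zero, one_smul, mul_neg,
    neg_smul, mul_one, mul_comm _ r, ← sub_eq_add_neg]

theorem continuous_expConv (r : ℝ) (hu : Continuous u) : Continuous (expConv r u) := by
  have h : Continuous fun s : ℝ => Real.exp (-(r * s)) • ∫ τ in (0 : ℝ)..s,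
      Real.exp (r * τ) • u τ.toNNReal :=
    continuous_iff_continuousAt.2 fun s => (hasDerivAt_expConv r hu s).continuousAt
  exact (h.comp NNReal.continuous_coe).congr fun t => (expConv_eq r u t).symm

/-- The integrated form of E' = u - r E with E(0) = 0. -/
theorem smul_integral_expConv (r : ℝ) (hu : Continuous u) (t : ℝ≥0) :
    r • ∫ s in (0 : ℝ)..t, expConv r u s.toNNReal
      = (∫ s in (0 : ℝ)..t, u s.toNNReal) - expConv r u t := by
  have hE : Continuous fun s : ℝ => Real.exp (-(r * s)) • ∫ τ in (0 : ℝ)..s,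
      Real.exp (r * τ) • u τ.toNNReal :=
    continuous_iff_continuousAt.2 fun s => (hasDerivAt_expConv r hu s).continuousAt
  have hE' : Continuous fun s : ℝ => r • Real.exp (-(r * s)) • ∫ τ in (0 : ℝ)..s,
      Real.exp (r * τ) • u τ.toNNReal := hE.const_smul r
  have hu' : Continuous fun s : ℝ => u s.toNNReal := by fun_prop
  have h1 := intervalIntegral.integral_eq_sub_of_hasDerivAt (a := 0) (b := (t : ℝ))
    (fun s _ => hasDerivAt_expConv r hu s)
    ((hu'.sub hE').intervalIntegrable _ _)
  rw [intervalIntegral.integral_sub (hu'.intervalIntegrable _ _)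
    (hE'.intervalIntegrable _ _), intervalIntegral.integral_smul,
    intervalIntegral.integral_same, smul_zero, sub_zero, ← expConv_eq] at h1
  rw [← h1, sub_sub_cancel]
  congr 1
  refine intervalIntegral.integral_congr fun s hs => ?_
  rw [uIcc_of_le t.coe_nonneg] at hs
  rw [expConv_eq, Real.coe_toNNReal _ hs.1]

end

/-! ### Beta and Gamma integrals of the fractional kernels -/

theorem intervalIntegrable_kernel_smul {β : ℝ} (hβ : 0 < β) {u : ℝ → X} (hu : Continuous u)
    (t : ℝ) :
    IntervalIntegrable (fun τ : ℝ => ((t - τ) ^ (β - 1) / Real.Gamma β) • u τ) volume 0 t := by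
  have h1 : IntervalIntegrable (fun x : ℝ => x ^ (β - 1)) volume t 0 :=
    intervalIntegral.intervalIntegrable_rpow' (by linarith)
  have h2 := (h1.comp_sub_left t).div_const (Real.Gamma β)
  simp only [sub_self, sub_zero] at h2
  exact h2.smul_continuousOn hu.continuousOn

/-- The Beta integral B(α, 1-α) = Γ(α)Γ(1-α). The exponents add up to -1, so the length of the
interval drops out and the kernels of orders α and 1 - α convolve to the constant 1. -/
theorem integral_beta_kernel {α : ℝ} (hα0 : 0 < α) (hα1 : α < 1) {a b : ℝ} (hab : a < b) :
    ∫ s in a..b, ((b - s) ^ (1 - α - 1) / Real.Gamma (1 - α)) * ((s - a) ^ (α - 1) / Real.Gamma α)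
      = 1 := by
  have hc : 0 < b - a := sub_pos.2 hab
  have h1 := Complex.betaIntegral_scaled (α : ℂ) ((1 - α : ℝ) : ℂ) hc
  have hG := Complex.Gamma_mul_Gamma_eq_betaIntegral (s := (α : ℂ)) (t := ((1 - α : ℝ) : ℂ))
    (by simpa using hα0) (by simpa using hα1)
  have hsum : (α : ℂ) + ((1 - α : ℝ) : ℂ) = 1 := by push_cast; ring
  rw [hsum, Complex.Gamma_one, one_mul, Complex.Gamma_ofReal, Complex.Gamma_ofReal] at hG
  rw [hsum, sub_self, Complex.cpow_zero, one_mul, ← hG] at h1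
  have h2 : ∫ x in (0 : ℝ)..(b - a), x ^ (α - 1) * (b - a - x) ^ (1 - α - 1)
      = Real.Gamma α * Real.Gamma (1 - α) := by
    apply Complex.ofReal_injective
    rw [← intervalIntegral.integral_ofReal]
    push_cast
    rw [← h1]
    refine intervalIntegral.integral_congr fun x hx => ?_
    rw [uIcc_of_le hc.le] at hx
    have e : (b : ℂ) - a - x = ((b - a - x : ℝ) : ℂ) := by push_cast; ring
    have e' : ((b - a : ℝ) : ℂ) - x = ((b - a - x : ℝ) : ℂ) := by push_cast; ring
    rw [Complex.ofReal_cpow hx.1, Complex.ofReal_cpow (sub_nonneg.2 hx.2)]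
    push_cast
    rfl
  have hΓ1 : Real.Gamma (1 - α) ≠ 0 := (Real.Gamma_pos_of_pos (by linarith)).ne'
  have hΓ : Real.Gamma α ≠ 0 := (Real.Gamma_pos_of_pos hα0).ne'
  have h3 := intervalIntegral.integral_comp_sub_right (a := a) (b := b)
    (fun x : ℝ => x ^ (α - 1) * (b - a - x) ^ (1 - α - 1)) a
  rw [sub_self, h2] at h3
  calc _ = (Real.Gamma α * Real.Gamma (1 - α))⁻¹ *
        ∫ s in a..b, (s - a) ^ (α - 1) * (b - a - (s - a)) ^ (1 - α - 1) := by
        rw [← intervalIntegral.integral_const_mul]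
        refine intervalIntegral.integral_congr fun s _ => ?_
        rw [sub_sub_sub_cancel_right]
        field_simp
    _ = 1 := by rw [h3]; field_simp

theorem integral_rpow_mul_exp {α : ℝ} (hα0 : 0 < α) {s : ℝ} (hs : 0 < s) :
    ∫ r in Ioi (0 : ℝ), r ^ (α - 1) * Real.exp (-(r * s)) = Real.Gamma α * s ^ (1 - α - 1) := by
  have h1 := Real.integral_rpow_mul_exp_neg_mul_Ioi hα0 hs
  have h2 : (1 / s) ^ α = s ^ (1 - α - 1) := by
    rw [one_div, Real.inv_rpow hs.le, ← Real.rpow_neg hs.le]; congr 1; ring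
  rw [← h2, mul_comm (Real.Gamma α), ← h1]
  simp only [mul_comm s]

/-! ### Weighted exponential convolutions -/

theorem norm_le_of_le (u : BUC n X) (t : ℝ≥0) :
    ∀ τ ≤ t, ‖u τ‖ ≤ ‖u‖ * (1 + (t : ℝ)) ^ n := fun τ hτ =>
  (norm_le_norm_mul_pow u τ).trans (by
    have : (τ : ℝ) ≤ t := hτ
    gcongr)

variable [CompleteSpace X]

open Classical in
/-- The function `(1 + t)^(-n) (e^(-r t) * u)`, for `r > 0`. -/
def weightedExpConv (u : BUC n X) (r : ℝ) : ℝ≥0 →ᵇ X :=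
  if hr : 0 < r then
    weightedOf n (expConv r u) (continuous_expConv r u.continuous_coe) (‖u‖ / r) fun t =>
      (norm_expConv_le hr (norm_le_of_le u t)).trans (le_of_eq (by ring))
  else 0

theorem weightedExpConv_apply (u : BUC n X) {r : ℝ} (hr : 0 < r) (t : ℝ≥0) :
    weightedExpConv u r t = ((1 + (t : ℝ)) ^ n)⁻¹ • expConv r u t := by
  rw [weightedExpConv, dif_pos hr, weightedOf_apply]

theorem norm_weightedExpConv_le (u : BUC n X) {r : ℝ} (hr : 0 < r) :
    ‖weightedExpConv u r‖ ≤ ‖u‖ / r := by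
  rw [weightedExpConv, dif_pos hr]
  exact norm_weightedOf_le

theorem continuousOn_weightedExpConv (u : BUC n X) :
    ContinuousOn (weightedExpConv u) (Ioi 0) := by
  intro r hr
  have hr : 0 < r := hr
  refine ContinuousAt.continuousWithinAt ?_
  rw [ContinuousAt, tendsto_iff_norm_sub_tendsto_zero]
  have hlim : Tendsto (fun r' : ℝ => 4 / (r / 2) ^ 2 * |r' - r| * ‖u‖) (𝓝 r) (𝓝 0) := by
    have : Continuous fun r' : ℝ => 4 / (r / 2) ^ 2 * |r' - r| * ‖u‖ := by fun_prop
    simpa using this.tendsto r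
  refine squeeze_zero' (Eventually.of_forall fun _ => norm_nonneg _) ?_ hlim
  filter_upwards [eventually_gt_nhds (half_lt_self hr)] with r' hr'
  refine (BoundedContinuousFunction.norm_le (by positivity)).2 fun t => ?_
  have hp : 0 < (1 + (t : ℝ)) ^ n := by positivity
  have hr'0 : 0 < r' := by linarith
  rw [BoundedContinuousFunction.coe_sub, Pi.sub_apply, weightedExpConv_apply u hr'0,
    weightedExpConv_apply u hr, ← smul_sub, norm_smul, Real.norm_of_nonneg (by positivity),
    inv_mul_le_iff₀ hp]
  refine (norm_expConv_sub_le (half_pos hr) hr'.le (half_le_self hr.le) u.continuous_coe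
    (norm_le_of_le u t)).trans (le_of_eq (by ring))

/-! ### Fractional integrals -/

/-- `J^(1 - α) J^α` is integration. -/
theorem fracInt_fracInt {α : ℝ} (hα0 : 0 < α) (hα1 : α < 1) {u : ℝ≥0 → X} (hu : Continuous u)
    (t : ℝ≥0) :
    IntervalIntegrable (fun s : ℝ => (((t : ℝ) - s) ^ (1 - α - 1) / Real.Gamma (1 - α)) •
        fracInt α u s.toNNReal) volume 0 t ∧
      fracInt (1 - α) (fracInt α u) t = ∫ τ in (0 : ℝ)..t, u τ.toNNReal := by
  set k : ℝ → ℝ := fun s => ((t : ℝ) - s) ^ (1 - α - 1) / Real.Gamma (1 - α) with hk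
  set k' : ℝ → ℝ := fun s => s ^ (α - 1) / Real.Gamma α with hk'
  have hΓ1 : 0 < Real.Gamma (1 - α) := Real.Gamma_pos_of_pos (by linarith)
  have hΓ : 0 < Real.Gamma α := Real.Gamma_pos_of_pos hα0
  set μ : Measure ℝ := volume.restrict (Ioo 0 (t : ℝ)) with hμ
  set g : ℝ × ℝ → X := fun p => (k p.1 * k' (p.1 - p.2)) • u p.2.toNNReal with hg
  -- The double integral lives on the triangle τ < s < t; the indicator turns it into one over a
  -- square, where Fubini applies.
  set F : ℝ → ℝ → X := fun s τ => {p : ℝ × ℝ | p.2 < p.1}.indicator g (s, τ) with hF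
  have hF1 : ∀ τ, (fun s => F s τ) = (Ioi τ).indicator fun s => g (s, τ) := fun τ => by
    ext s; simp [hF, indicator]
  have hF2 : ∀ s, (fun τ => F s τ) = (Iio s).indicator fun τ => g (s, τ) := fun s => by
    ext τ; simp [hF, indicator]
  have hbeta : ∀ τ ∈ Ioo 0 (t : ℝ), ∫ s in Ioo τ (t : ℝ), k s * k' (s - τ) = 1 := fun τ hτ => by
    have := integral_beta_kernel hα0 hα1 hτ.2
    rwa [intervalIntegral.integral_of_le hτ.2.le, integral_Ioc_eq_integral_Ioo] at this
  have hbi : ∀ τ ∈ Ioo 0 (t : ℝ), IntegrableOn (fun s => k s * k' (s - τ)) (Ioo τ t) :=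
    fun τ hτ => by
      -- A non-integrable function has integral 0 by convention, whereas the Beta computation gives
      -- 1.
      by_contra h
      have := hbeta τ hτ
      rw [integral_undef h] at this
      exact zero_ne_one this
  have hinter : ∀ τ ∈ Ioo 0 (t : ℝ), Ioi τ ∩ Ioo 0 (t : ℝ) = Ioo τ t := fun τ hτ => by
    ext s; simp only [mem_inter_iff, mem_Ioi, mem_Ioo]
    exact ⟨fun h => ⟨h.1, h.2.2⟩, fun h => ⟨h.1, hτ.1.trans h.1, h.2⟩⟩
  have hinter' : ∀ s ∈ Ioo 0 (t : ℝ), Iio s ∩ Ioo 0 (t : ℝ) = Ioo 0 s := fun s hs => by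
    ext τ; simp only [mem_inter_iff, mem_Iio, mem_Ioo]
    exact ⟨fun h => ⟨h.2.1, h.1⟩, fun h => ⟨h.2, h.1, h.2.trans hs.2⟩⟩
  have hu' : Continuous fun τ : ℝ => u τ.toNNReal := by fun_prop
  have hmeas : AEStronglyMeasurable (Function.uncurry F) (μ.prod μ) := by
    have h1 : Measurable fun p : ℝ × ℝ => k p.1 * k' (p.1 - p.2) := by fun_prop
    have h2 : Continuous fun p : ℝ × ℝ => u p.2.toNNReal := by fun_prop
    have h3 : AEStronglyMeasurable g (μ.prod μ) :=
      h1.aestronglyMeasurable.smul h2.aestronglyMeasurable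
    exact h3.indicator (measurableSet_lt measurable_snd measurable_fst)
  have hu0 : IntegrableOn (fun τ : ℝ => u τ.toNNReal) (Ioo 0 t) :=
    (hu'.integrableOn_Icc (a := 0) (b := (t : ℝ))).mono_set Ioo_subset_Icc_self
  have hint : Integrable (Function.uncurry F) (μ.prod μ) := by
    rw [integrable_prod_iff' hmeas]
    constructor
    · filter_upwards [ae_restrict_mem measurableSet_Ioo] with τ hτ
      change Integrable (fun s => F s τ) μ
      rw [hF1, integrable_indicator_iff measurableSet_Ioi, IntegrableOn, hμ,
        Measure.restrict_restrict measurableSet_Ioi, hinter τ hτ]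
      exact (hbi τ hτ).smul_const (u τ.toNNReal)
    · refine hu0.norm.congr ?_
      filter_upwards [ae_restrict_mem measurableSet_Ioo] with τ hτ
      change _ = ∫ s, ‖F s τ‖ ∂μ
      have : (fun s => ‖F s τ‖) = (Ioi τ).indicator fun s => ‖g (s, τ)‖ := by
        ext s
        have := congrFun (hF1 τ) s
        rw [this, norm_indicator_eq_indicator_norm]
      rw [this, integral_indicator measurableSet_Ioi, hμ,
        Measure.restrict_restrict measurableSet_Ioi, hinter τ hτ]
      rw [← one_mul ‖u _‖, ← hbeta τ hτ, ← integral_mul_const]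
      refine setIntegral_congr_fun measurableSet_Ioo fun s hs => ?_
      simp only [hg]
      rw [norm_smul, Real.norm_of_nonneg]
      have h1 : 0 ≤ (t : ℝ) - s := sub_nonneg.2 hs.2.le
      have h2 : 0 ≤ s - τ := sub_nonneg.2 hs.1.le
      positivity
  have hin1 : ∀ s ∈ Ioo 0 (t : ℝ), ∫ τ, F s τ ∂μ = k s • fracInt α u s.toNNReal := fun s hs => by
    rw [hF2, integral_indicator measurableSet_Iio, hμ,
      Measure.restrict_restrict measurableSet_Iio, hinter' s hs, fracInt,
      Real.coe_toNNReal _ hs.1.le, intervalIntegral.integral_of_le hs.1.le,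
      integral_Ioc_eq_integral_Ioo, ← integral_smul]
    simp only [hg, hk', mul_smul]
  have hin2 : ∀ τ ∈ Ioo 0 (t : ℝ), ∫ s, F s τ ∂μ = u τ.toNNReal := fun τ hτ => by
    rw [hF1, integral_indicator measurableSet_Ioi, hμ,
      Measure.restrict_restrict measurableSet_Ioi, hinter τ hτ]
    simp only [hg]
    rw [integral_smul_const, hbeta τ hτ, one_smul]
  constructor
  · rw [intervalIntegrable_iff_integrableOn_Ioo_of_le t.coe_nonneg]
    refine (hint.integral_prod_left).congr ?_
    filter_upwards [ae_restrict_mem measurableSet_Ioo] with s hs using hin1 s hs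
  · rw [fracInt, intervalIntegral.integral_of_le t.coe_nonneg,
      intervalIntegral.integral_of_le t.coe_nonneg, integral_Ioc_eq_integral_Ioo,
      integral_Ioc_eq_integral_Ioo]
    rw [← setIntegral_congr_fun measurableSet_Ioo hin2, ← integral_integral_swap hint]
    exact (setIntegral_congr_fun measurableSet_Ioo hin1).symm

/-- The fractional integral of order `1 - α` as a superposition of exponential convolutions. -/
theorem integral_expConv {α : ℝ} (hα0 : 0 < α) (hα1 : α < 1) {u : ℝ≥0 → X} (hu : Continuous u)
    (t : ℝ≥0) :
    IntegrableOn (fun r : ℝ => r ^ (α - 1) • expConv r u t) (Ioi 0) ∧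
      ∫ r in Ioi (0 : ℝ), r ^ (α - 1) • expConv r u t
        = (Real.Gamma α * Real.Gamma (1 - α)) • fracInt (1 - α) u t := by
  have hΓ1 : 0 < Real.Gamma (1 - α) := Real.Gamma_pos_of_pos (by linarith)
  have hΓ : 0 < Real.Gamma α := Real.Gamma_pos_of_pos hα0
  set μ : Measure ℝ := volume.restrict (Ioi 0) with hμ
  set ν : Measure ℝ := volume.restrict (Ioo 0 (t : ℝ)) with hν
  set F : ℝ → ℝ → X := fun r τ =>
    (r ^ (α - 1) * Real.exp (-(r * (t - τ)))) • u τ.toNNReal with hF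
  have hker : ∀ τ ∈ Ioo 0 (t : ℝ), ∫ r, r ^ (α - 1) * Real.exp (-(r * (t - τ))) ∂μ
      = Real.Gamma α * (t - τ) ^ (1 - α - 1) := fun τ hτ =>
    integral_rpow_mul_exp hα0 (sub_pos.2 hτ.2)
  have hi : ∀ τ ∈ Ioo 0 (t : ℝ), Integrable (fun r => r ^ (α - 1) * Real.exp (-(r * (t - τ)))) μ :=
    fun τ hτ => by
      by_contra h
      have h1 := hker τ hτ
      rw [integral_undef h] at h1
      have : 0 < (t : ℝ) - τ := sub_pos.2 hτ.2
      have : 0 < Real.Gamma α * (t - τ) ^ (1 - α - 1) := by positivity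
      linarith
  have hmeas : AEStronglyMeasurable (Function.uncurry F) (μ.prod ν) := by
    have h1 : Measurable fun p : ℝ × ℝ => p.1 ^ (α - 1) * Real.exp (-(p.1 * (t - p.2))) := by
      fun_prop
    have h2 : Continuous fun p : ℝ × ℝ => u p.2.toNNReal := by fun_prop
    exact h1.aestronglyMeasurable.smul h2.aestronglyMeasurable
  have hu' : Continuous fun τ : ℝ => u τ.toNNReal := by fun_prop
  have hint : Integrable (Function.uncurry F) (μ.prod ν) := by
    rw [integrable_prod_iff' hmeas]
    constructor
    · filter_upwards [ae_restrict_mem measurableSet_Ioo] with τ hτ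
      exact (hi τ hτ).smul_const (u τ.toNNReal)
    · have h1 := intervalIntegrable_kernel_smul (β := 1 - α) (by linarith)
        (Complex.continuous_ofReal.comp hu'.norm) t
      rw [intervalIntegrable_iff_integrableOn_Ioo_of_le t.coe_nonneg] at h1
      refine (h1.norm.const_mul (Real.Gamma α * Real.Gamma (1 - α))).congr ?_
      filter_upwards [ae_restrict_mem measurableSet_Ioo] with τ hτ
      change _ = ∫ r, ‖F r τ‖ ∂μ
      have h2 : ∫ r, ‖F r τ‖ ∂μ
          = ∫ r, r ^ (α - 1) * Real.exp (-(r * (t - τ))) * ‖u τ.toNNReal‖ ∂μ := by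
        refine setIntegral_congr_fun measurableSet_Ioi fun r (hr : 0 < r) => ?_
        simp only [hF]
        rw [norm_smul, Real.norm_of_nonneg (by positivity)]
      have h3 : 0 ≤ (t : ℝ) - τ := sub_nonneg.2 hτ.2.le
      rw [h2, integral_mul_const, hker τ hτ, norm_smul, Real.norm_of_nonneg (by positivity)]
      simp only [Function.comp, Complex.norm_real, norm_norm]
      field_simp
  have hin1 : ∀ r, ∫ τ, F r τ ∂ν = r ^ (α - 1) • expConv r u t := fun r => by
    rw [expConv, intervalIntegral.integral_of_le t.coe_nonneg, integral_Ioc_eq_integral_Ioo,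
      ← integral_smul]
    simp only [hF, mul_smul, hν]
  constructor
  · exact (hint.integral_prod_left).congr (Eventually.of_forall hin1)
  · calc _ = ∫ r, ∫ τ, F r τ ∂ν ∂μ := by simp only [hin1]
      _ = ∫ τ, ∫ r, F r τ ∂μ ∂ν := integral_integral_swap hint
      _ = ∫ τ in Ioo 0 (t : ℝ), (Real.Gamma α * Real.Gamma (1 - α)) •
            (((t : ℝ) - τ) ^ (1 - α - 1) / Real.Gamma (1 - α)) • u τ.toNNReal := by
          refine setIntegral_congr_fun measurableSet_Ioo fun τ hτ => ?_
          simp only [hF]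
          rw [integral_smul_const, hker τ hτ, smul_smul]
          congr 1
          field_simp
      _ = _ := by
          rw [integral_smul, fracInt, intervalIntegral.integral_of_le t.coe_nonneg,
            integral_Ioc_eq_integral_Ioo]

end

/-! ### Analytic continuation of the Carleman transform of a mild solution -/

section

variable {X : Type*} [NormedAddCommGroup X] [NormedSpace ℂ X] {n : ℕ}

/-- Composition of a bounded function with a bounded operator, as a bounded bilinear map. -/
def postcomp : (X →L[ℂ] X) →L[ℂ] (ℝ≥0 →ᵇ X) →L[ℂ] (ℝ≥0 →ᵇ X) :=
  LinearMap.mkContinuous₂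
    (LinearMap.mk₂ ℂ (fun T h => T.compLeftContinuousBounded ℝ≥0 h)
      (fun _ _ _ => by ext; simp) (fun _ _ _ => by ext; simp)
      (fun _ _ _ => by ext; simp) (fun _ _ _ => by ext; simp)) 1 fun T h => by
    refine (BoundedContinuousFunction.norm_le (by positivity)).2 fun t => ?_
    rw [one_mul]
    exact (T.le_opNorm _).trans (by gcongr; exact h.norm_coe_le_norm t)

theorem postcomp_apply (T : X →L[ℂ] X) (h : ℝ≥0 →ᵇ X) (t : ℝ≥0) : postcomp T h t = T (h t) := rfl

/-- The functional calculus identity satisfied by a mild solution. -/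
theorem IsMildSolution.fracInt_eq {A : X →ₗ.[ℂ] X} {α : ℝ} {f u : ℝ≥0 → X}
    (hu : IsMildSolution A α f u) {ζ : ℂ} {T : X →L[ℂ] X} (hT : IsResolvent A ζ T) (t : ℝ≥0) :
    fracInt α u t = T (ζ • fracInt α u t - u t + fracInt α f t + u 0) := by
  obtain ⟨h, he⟩ := hu.2 t
  have h1 : T (ζ • fracInt α u t - A ⟨_, h⟩) = fracInt α u t := hT.2 ⟨_, h⟩
  refine h1.symm.trans (congrArg T ?_)
  rw [he]
  abel

theorem map_smul_real (T : X →L[ℂ] X) (c : ℝ) (x : X) : T (c • x) = c • T x :=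
  T.map_smul_of_tower c x

variable [CompleteSpace X]

/-- Differentiating the integrated equation gives y' = z y - u + T f + K' x. Here T f is negligible
because f ∈ C_{0,n}, and K' x because K' → 0. Stating it in integrated form means that y need only
be continuous. -/
theorem apply_eq_carleman_of_integrated {φ : (ℝ≥0 →ᵇ X) →L[ℂ] ℂ}
    (hφ : ∀ h : ℝ≥0 →ᵇ X, Tendsto h atTop (𝓝 0) → φ h = 0) {f u : BUC n X} (hf : IsC0 f)
    {z : ℂ} (hz : z.re ≠ 0) (T : X →L[ℂ] X) {y : ℝ≥0 → X} (hyc : Continuous y) {w : ℝ≥0 →ᵇ X}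
    (hw : ∀ t : ℝ≥0, w t = ((1 + (t : ℝ)) ^ n)⁻¹ • y t) {K K' : ℝ → ℝ}
    (hK : ∀ t, 0 < t → HasDerivAt K (K' t) t) (hKc : ContinuousOn K' (Ioi 0))
    (hK0 : Tendsto K' atTop (𝓝 0)) (x : X)
    (hy : ∀ t : ℝ≥0, y t = z • (∫ s in (0 : ℝ)..t, y s.toNNReal)
      - (∫ s in (0 : ℝ)..t, u s.toNNReal) + T (∫ s in (0 : ℝ)..t, f s.toNNReal) + K t • x) :
    φ w = carleman (fun s => φ (shift s (weighted u))) z := by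
  have hfc := f.continuous_coe
  have huc := u.continuous_coe
  refine apply_eq_carleman_weighted hφ u hz (y := fun t => y t.toNNReal)
    (e := fun t => T (f t.toNNReal) + K' t • x) (fun t => ?_) ?_ ?_ fun t ht => ?_
  · rw [hw, Real.toNNReal_coe]
  · have h1 : Continuous fun t : ℝ => T (f t.toNNReal) := by fun_prop
    exact h1.continuousOn.add (hKc.smul continuousOn_const)
  · have h1 : Tendsto (fun t : ℝ => ‖f t.toNNReal‖ / (1 + t) ^ n) atTop (𝓝 0) := by
      refine (hf.comp tendsto_real_toNNReal_atTop).congr' ?_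
      filter_upwards [eventually_ge_atTop 0] with t ht
      simp only [Function.comp, Real.coe_toNNReal _ ht]
    have h2 : Tendsto (fun t : ℝ => ‖T‖ * (‖f t.toNNReal‖ / (1 + t) ^ n) + |K' t| * ‖x‖) atTop
        (𝓝 0) := by
      simpa using (h1.const_mul ‖T‖).add (hK0.abs.mul_const ‖x‖)
    refine squeeze_zero_norm' ?_ h2
    filter_upwards [eventually_ge_atTop 0] with t ht
    have hp : 1 ≤ (1 + t) ^ n := one_le_pow₀ (by linarith)
    have hp0 : 0 < (1 + t) ^ n := by linarith
    rw [smul_add]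
    refine (norm_add_le _ _).trans (add_le_add ?_ ?_)
    · rw [norm_smul, Real.norm_of_nonneg (by positivity)]
      calc ((1 + t) ^ n)⁻¹ * ‖T (f t.toNNReal)‖
          ≤ ((1 + t) ^ n)⁻¹ * (‖T‖ * ‖f t.toNNReal‖) := by gcongr; exact T.le_opNorm _
        _ = _ := by ring
    · rw [norm_smul, norm_smul, Real.norm_of_nonneg (by positivity), Real.norm_eq_abs]
      exact mul_le_of_le_one_left (by positivity) (inv_le_one_of_one_le₀ hp)
  · have hy' : Continuous fun s : ℝ => y s.toNNReal := by fun_prop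
    have hu' : Continuous fun s : ℝ => u s.toNNReal := by fun_prop
    have hf' : Continuous fun s : ℝ => f s.toNNReal := by fun_prop
    have h1 := (hy'.integral_hasStrictDerivAt 0 t).hasDerivAt.const_smul z
    have h2 := (hu'.integral_hasStrictDerivAt 0 t).hasDerivAt
    have h3 := (T.restrictScalars ℝ).hasFDerivAt.comp_hasDerivAt t
      (hf'.integral_hasStrictDerivAt 0 t).hasDerivAt
    have h4 := (hK t ht).smul_const x
    refine ((((h1.sub h2).add h3).add h4).congr_deriv ?_).congr_of_eventuallyEq ?_
    · simp only [ContinuousLinearMap.coe_restrictScalars']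
      abel
    · filter_upwards [eventually_gt_nhds ht] with s hs
      rw [hy, Real.coe_toNNReal _ hs.le]
      rfl

/-- The continuation of the Carleman transform, for equations of order one. -/
theorem extendsAt_carleman_one {φ : (ℝ≥0 →ᵇ X) →L[ℂ] ℂ}
    (hφ : ∀ h : ℝ≥0 →ᵇ X, Tendsto h atTop (𝓝 0) → φ h = 0) {A : X →ₗ.[ℂ] X}
    {f u : BUC n X} (hf : IsC0 f) (hu : IsMildSolution A 1 (fun t => f t) (fun t => u t))
    {c : ℂ} (hc : c ∈ rhoSet A 1) :
    ExtendsAt (carleman fun s => φ (shift s (weighted u))) c := by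
  obtain ⟨U, hU, hcU, R, hR, hRa⟩ := hc
  refine ⟨fun z => φ (postcomp (R z) (weighted u)), ?_, ?_⟩
  · refine DifferentiableOn.analyticAt (s := U) (fun z hz => ?_) (hU.mem_nhds hcU)
    have h1 : DifferentiableAt ℂ R z := (hRa z hz).differentiableAt
    have h2 : DifferentiableAt ℂ (fun z => postcomp (R z) (weighted u)) z :=
      (postcomp.differentiableAt.comp z h1).clm_apply (differentiableAt_const _)
    exact (φ.differentiableAt.comp z h2).differentiableWithinAt
  · filter_upwards [hU.mem_nhds hcU] with z hz hz0
    have hT := hR z hz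
    rw [Complex.ofReal_one, Complex.cpow_one] at hT
    have huc := u.continuous_coe
    have hu' : Continuous fun s : ℝ => u s.toNNReal := by fun_prop
    have hone : ∀ (g : ℝ≥0 → X) (t : ℝ≥0), fracInt 1 g t = ∫ s in (0 : ℝ)..t, g s.toNNReal :=
      fun g t => by simp [fracInt]
    -- Applying (z - A)⁻¹ to the mild equation gives ∫u = (z - A)⁻¹(z∫u - u + ∫f + u(0)). Solved for
    -- (z - A)⁻¹u it has the required form, the initial value entering as a constant with zero
    -- derivative.
    refine apply_eq_carleman_of_integrated hφ hf hz0 (R z) (y := fun t => R z (u t)) (by fun_prop)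
      (fun t => ?_) (K := fun _ => 1) (K' := fun _ => 0) (fun t _ => hasDerivAt_const t 1)
      continuousOn_const tendsto_const_nhds (R z (u 0)) fun t => ?_
    · rw [postcomp_apply, weighted_apply]
      exact ((R z).restrictScalars ℝ).map_smul _ _
    · have h1 := hu.fracInt_eq hT t
      rw [hone, hone, map_add, map_add, map_sub, map_smul] at h1
      rw [(R z).intervalIntegral_comp_comm (hu'.intervalIntegrable _ _), one_smul]
      nth_rewrite 2 [h1]
      abel

/-! ### Orders less than one -/

variable {α : ℝ}

/-- Apply J^(1-α) to `fracInt_eq`: it commutes with the bounded operator T, turns J^α u and J^α f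
into ordinary integrals, and sends the constant u(0) to t^(1-α)/Γ(2-α) times it. Only J^(1-α)u
remains fractional. -/
theorem IsMildSolution.integral_eq (hα0 : 0 < α) (hα1 : α < 1) {A : X →ₗ.[ℂ] X} {f u : ℝ≥0 → X}
    (hfc : Continuous f) (hu : IsMildSolution A α f u) {ζ : ℂ} {T : X →L[ℂ] X}
    (hT : IsResolvent A ζ T) (t : ℝ≥0) :
    ∫ s in (0 : ℝ)..t, u s.toNNReal = T (ζ • (∫ s in (0 : ℝ)..t, u s.toNNReal)
      - fracInt (1 - α) u t + (∫ s in (0 : ℝ)..t, f s.toNNReal)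
      + ((t : ℝ) ^ (1 - α) / ((1 - α) * Real.Gamma (1 - α))) • u 0) := by
  have huc := hu.1
  have hβ : 0 < 1 - α := by linarith
  obtain ⟨hi1, he1⟩ := fracInt_fracInt hα0 hα1 huc t
  obtain ⟨hi2, he2⟩ := fracInt_fracInt hα0 hα1 hfc t
  have hi3 := intervalIntegrable_kernel_smul hβ (huc.comp continuous_real_toNNReal) t
  have hi4 := intervalIntegrable_kernel_smul hβ (continuous_const (y := u 0)) t
  have h4 : ∫ τ in (0 : ℝ)..t, (((t : ℝ) - τ) ^ (1 - α - 1) / Real.Gamma (1 - α)) • u 0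
      = ((t : ℝ) ^ (1 - α) / ((1 - α) * Real.Gamma (1 - α))) • u 0 := by
    rw [intervalIntegral.integral_smul_const, intervalIntegral.integral_div,
      intervalIntegral.integral_comp_sub_left (fun x : ℝ => x ^ (1 - α - 1)), sub_self, sub_zero,
      integral_rpow (Or.inl (by linarith)), sub_add_cancel, Real.zero_rpow hβ.ne', sub_zero,
      div_div]
  rw [← he1, ← he2, ← h4]
  set k : ℝ → ℝ := fun s => ((t : ℝ) - s) ^ (1 - α - 1) / Real.Gamma (1 - α) with hk
  have h5 : ∀ s, k s • fracInt α u s.toNNReal = T (ζ • (k s • fracInt α u s.toNNReal)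
      - k s • u s.toNNReal + k s • fracInt α f s.toNNReal + k s • u 0) := fun s => by
    conv_lhs => rw [hu.fracInt_eq hT]
    rw [← map_smul_real, smul_add, smul_add, smul_sub, smul_comm (k s) ζ]
  have hj1 : IntervalIntegrable (fun s => ζ • (k s • fracInt α u s.toNNReal)) volume 0 t :=
    hi1.smul ζ
  have hj2 : IntervalIntegrable (fun s => k s • u s.toNNReal) volume 0 t := hi3
  have hj3 : IntervalIntegrable (fun s => ζ • (k s • fracInt α u s.toNNReal)
      - k s • u s.toNNReal) volume 0 t := hj1.sub hj2
  have hj4 : IntervalIntegrable (fun s => ζ • (k s • fracInt α u s.toNNReal)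
      - k s • u s.toNNReal + k s • fracInt α f s.toNNReal) volume 0 t := hj3.add hi2
  have hi : IntervalIntegrable (fun s => ζ • (k s • fracInt α u s.toNNReal)
      - k s • u s.toNNReal + k s • fracInt α f s.toNNReal + k s • u 0) volume 0 t :=
    hj4.add hi4
  calc fracInt (1 - α) (fracInt α u) t
      = ∫ s in (0 : ℝ)..t, k s • fracInt α u s.toNNReal := rfl
    _ = T (∫ s in (0 : ℝ)..t, (ζ • (k s • fracInt α u s.toNNReal)
      - k s • u s.toNNReal + k s • fracInt α f s.toNNReal + k s • u 0)) := by
        rw [← T.intervalIntegral_comp_comm hi]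
        exact intervalIntegral.integral_congr fun s _ => h5 s
    _ = _ := by
        rw [intervalIntegral.integral_add hj4 hi4, intervalIntegral.integral_add hj3 hi2,
          intervalIntegral.integral_sub hj1 hj2, intervalIntegral.integral_smul]
        rfl

/-! ### The Stieltjes superposition of exponential convolutions -/

/-- The density of the weighted superposition of exponential convolutions. -/
def expConvDensity (α : ℝ) (u : BUC n X) (r : ℝ) : ℝ≥0 →ᵇ X :=
  ((r ^ α : ℝ) : ℂ) • weightedExpConv u r

theorem aestronglyMeasurable_expConvDensity (α : ℝ) (u : BUC n X) :
    AEStronglyMeasurable (expConvDensity α u) (volume.restrict (Ioi 0)) := by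
  have h : ContinuousOn (fun r : ℝ => ((r ^ α : ℝ) : ℂ)) (Ioi 0) := ?_
  · exact ContinuousOn.aestronglyMeasurable (h.smul (continuousOn_weightedExpConv u))
      measurableSet_Ioi
  refine Complex.continuous_ofReal.comp_continuousOn fun r hr => ?_
  exact (Real.continuousAt_rpow_const r α (Or.inl (ne_of_gt hr))).continuousWithinAt

theorem integrableOn_expConvDensity (hα0 : 0 < α) (hα1 : α < 1) (u : BUC n X) :
    IntegrableOn (fun r => ‖expConvDensity α u r‖ / (1 + r)) (Ioi 0) := by
  refine Integrable.mono' ((integrableOn_rpow_div hα0 hα1).const_mul ‖u‖) ?_ ?_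
  · have h : Measurable fun r : ℝ => (1 + r)⁻¹ := by fun_prop
    simp only [div_eq_mul_inv]
    exact (aestronglyMeasurable_expConvDensity α u).norm.mul h.aestronglyMeasurable
  · filter_upwards [ae_restrict_mem measurableSet_Ioi] with r hr
    have hr : 0 < r := hr
    rw [Real.norm_of_nonneg (by positivity), expConvDensity, norm_smul, Complex.norm_real,
      Real.norm_of_nonneg (by positivity), Real.rpow_sub_one hr.ne']
    calc r ^ α * ‖weightedExpConv u r‖ / (1 + r) ≤ r ^ α * (‖u‖ / r) / (1 + r) := by
          gcongr; exact norm_weightedExpConv_le u hr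
      _ = _ := by ring

/-- Integration against the weight, as a functional on the weighted space. -/
def weightedIntegral (n : ℕ) (X : Type*) [NormedAddCommGroup X] [NormedSpace ℂ X]
    (t : ℝ≥0) : (ℝ≥0 →ᵇ X) →L[ℂ] X :=
  LinearMap.mkContinuous
    { toFun := fun h => ∫ s in (0 : ℝ)..t, (1 + s) ^ n • h s.toNNReal
      map_add' := fun g h => by
        have hg : Continuous fun s : ℝ => (1 + s) ^ n • g s.toNNReal := by fun_prop
        have hh : Continuous fun s : ℝ => (1 + s) ^ n • h s.toNNReal := by fun_prop
        rw [← intervalIntegral.integral_add (hg.intervalIntegrable _ _) (hh.intervalIntegrable _ _)]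
        simp
      map_smul' := fun c h => by
        rw [RingHom.id_apply, ← intervalIntegral.integral_smul]
        refine intervalIntegral.integral_congr fun s _ => ?_
        exact smul_comm _ _ _ }
    ((1 + (t : ℝ)) ^ n * t) fun h => by
      have := intervalIntegral.norm_integral_le_of_norm_le_const (a := 0) (b := (t : ℝ))
        (f := fun s : ℝ => (1 + s) ^ n • h s.toNNReal) (C := (1 + (t : ℝ)) ^ n * ‖h‖) fun s hs => by
          rw [uIoc_of_le t.coe_nonneg] at hs
          have h0 : 0 ≤ s := hs.1.le
          rw [norm_smul, Real.norm_of_nonneg (by positivity)]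
          have := hs.2
          gcongr
          exact h.norm_coe_le_norm _
      rw [sub_zero, abs_of_nonneg t.coe_nonneg] at this
      exact this.trans (le_of_eq (by ring))

theorem weightedIntegral_apply (X : Type*) [NormedAddCommGroup X] [NormedSpace ℂ X] (t : ℝ≥0)
    (h : ℝ≥0 →ᵇ X) : weightedIntegral n X t h = ∫ s in (0 : ℝ)..t, (1 + s) ^ n • h s.toNNReal := rfl

/-- The unweighted superposition of exponential convolutions. -/
def expConvStieltjes (α : ℝ) (u : BUC n X) (z : ℂ) (t : ℝ≥0) : X :=
  (1 + (t : ℝ)) ^ n • stieltjes (expConvDensity α u) z t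

theorem continuous_expConvStieltjes (α : ℝ) (u : BUC n X) (z : ℂ) :
    Continuous (expConvStieltjes α u z) := by
  unfold expConvStieltjes
  fun_prop

/-- On the Laplace side the superposition multiplies by ∫ r^α / ((r+z)(r+λ)) dr = Γ(α)Γ(1-α) (λ^α -
z^α)/(λ - z). The identity is this divided difference with λ - z cleared and one integration in
time. -/
theorem smul_integral_expConvStieltjes (hα0 : 0 < α) (hα1 : α < 1) (u : BUC n X) {z : ℂ}
    (hz : z ∈ Complex.slitPlane) (t : ℝ≥0) :
    z • ∫ s in (0 : ℝ)..t, expConvStieltjes α u z s.toNNReal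
      = (Real.Gamma α * Real.Gamma (1 - α) : ℝ) •
          (z ^ (α : ℂ) • (∫ s in (0 : ℝ)..t, u s.toNNReal) - fracInt (1 - α) u t)
        + expConvStieltjes α u z t := by
  have hm := aestronglyMeasurable_expConvDensity α u
  have hi := integrableOn_stieltjes hm (integrableOn_expConvDensity hα0 hα1 u) hz
  have hz0 : z ≠ 0 := Complex.slitPlane_ne_zero hz
  set I : X := ∫ s in (0 : ℝ)..t, u s.toNNReal with hI
  have hrz : ∀ r : ℝ, 0 < r → (r : ℂ) + z ≠ 0 := fun r hr => by
    obtain ⟨δ, hδ, H⟩ := exists_mul_one_add_le_norm_add hz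
    have := H z (Metric.mem_ball_self hδ) r hr.le
    exact norm_pos_iff.1 (lt_of_lt_of_le (by positivity) this)
  have hi1 : IntegrableOn (fun r : ℝ => ((r : ℂ) + z)⁻¹ • ((r ^ (α - 1) : ℝ) : ℂ)) (Ioi 0) := by
    refine integrableOn_stieltjes ?_ ?_ hz
    · have : Measurable fun r : ℝ => ((r ^ (α - 1) : ℝ) : ℂ) := by fun_prop
      exact this.aestronglyMeasurable
    · refine (integrableOn_rpow_div hα0 hα1).congr_fun (fun r (hr : 0 < r) => ?_) measurableSet_Ioi
      simp only
      rw [Complex.norm_real, Real.norm_of_nonneg (by positivity)]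
  obtain ⟨hi2, he2⟩ := integral_expConv hα0 hα1 u.continuous_coe t
  have hp : (1 + (t : ℝ)) ^ n ≠ 0 := by positivity
  have hval : ∀ r : ℝ, 0 < r → (1 + (t : ℝ)) ^ n • ((r : ℂ) + z)⁻¹ • expConvDensity α u r t
      = (((r : ℂ) + z)⁻¹ * ((r ^ α : ℝ) : ℂ)) • expConv r u t := fun r hr => by
    rw [expConvDensity, BoundedContinuousFunction.smul_apply, weightedExpConv_apply u hr,
      smul_smul, smul_comm ((1 + (t : ℝ)) ^ n), smul_inv_smul₀ hp]
  have hi3 : IntegrableOn (fun r : ℝ => (((r : ℂ) + z)⁻¹ * ((r ^ α : ℝ) : ℂ)) • expConv r u t)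
      (Ioi 0) := by
    have h1 := ((BoundedContinuousFunction.evalCLM ℂ (β := X) t).integrable_comp hi).smul
      ((1 + (t : ℝ)) ^ n)
    refine h1.congr ?_
    filter_upwards [ae_restrict_mem measurableSet_Ioi] with r hr using hval r hr
  have he3 : expConvStieltjes α u z t
      = ∫ r in Ioi (0 : ℝ), (((r : ℂ) + z)⁻¹ * ((r ^ α : ℝ) : ℂ)) • expConv r u t := by
    have h1 := (BoundedContinuousFunction.evalCLM ℂ (β := X) t).integral_comp_comm hi
    have h2 : stieltjes (expConvDensity α u) z t
        = ∫ r in Ioi (0 : ℝ), ((r : ℂ) + z)⁻¹ • expConvDensity α u r t := h1.symm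
    rw [expConvStieltjes, h2, ← integral_smul]
    exact setIntegral_congr_fun measurableSet_Ioi hval
  -- The time integral is a bounded functional on the weighted space, so it passes through the
  -- Bochner integral. There r∫E_r = ∫u - E_r lowers r^α to r^(α-1).
  have hL : ∫ s in (0 : ℝ)..t, expConvStieltjes α u z s.toNNReal
      = ∫ r in Ioi (0 : ℝ), ((r : ℂ) + z)⁻¹ • ((r ^ (α - 1) : ℝ) : ℂ) • (I - expConv r u t) := by
    have h1 := (weightedIntegral n X t).integral_comp_comm hi
    have h2 : ∫ s in (0 : ℝ)..t, expConvStieltjes α u z s.toNNReal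
        = weightedIntegral n X t (stieltjes (expConvDensity α u) z) := by
      rw [weightedIntegral_apply]
      refine intervalIntegral.integral_congr fun s hs => ?_
      rw [uIcc_of_le t.coe_nonneg] at hs
      simp only [expConvStieltjes]
      rw [Real.coe_toNNReal _ hs.1]
    rw [h2, stieltjes, ← h1]
    refine setIntegral_congr_fun measurableSet_Ioi fun r (hr : 0 < r) => ?_
    have h3 : weightedIntegral n X t (weightedExpConv u r)
        = ∫ s in (0 : ℝ)..t, expConv r u s.toNNReal := by
      rw [weightedIntegral_apply]
      refine intervalIntegral.integral_congr fun s hs => ?_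
      rw [uIcc_of_le t.coe_nonneg] at hs
      have h0 : 0 ≤ s := hs.1
      have hp : (1 + s) ^ n ≠ 0 := by positivity
      rw [weightedExpConv_apply u hr, Real.coe_toNNReal _ h0, smul_inv_smul₀ hp]
    have h4 := smul_integral_expConv r u.continuous_coe t
    rw [expConvDensity, map_smul, map_smul, h3, hI, ← h4, Real.rpow_sub_one hr.ne',
      ← Complex.coe_smul r, smul_smul ((r ^ α / r : ℝ) : ℂ), ← Complex.ofReal_mul,
      div_mul_cancel₀ _ hr.ne']
  have hsc : ∫ r in Ioi (0 : ℝ), ((r : ℂ) + z)⁻¹ • ((r ^ (α - 1) : ℝ) : ℂ)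
      = (Real.Gamma α * Real.Gamma (1 - α) : ℝ) * z ^ ((α : ℂ) - 1) := stieltjes_rpow hα0 hα1 hz
  -- From z/(r+z) = 1 - r/(r+z): the three terms integrate to z^α∫u, to J^(1-α)u and back to the
  -- superposition itself.
  have hpt : ∀ r ∈ Ioi (0 : ℝ),
      z • ((r : ℂ) + z)⁻¹ • ((r ^ (α - 1) : ℝ) : ℂ) • (I - expConv r u t)
      = (((r : ℂ) + z)⁻¹ • ((r ^ (α - 1) : ℝ) : ℂ)) • (z • I) - r ^ (α - 1) • expConv r u t
        + (((r : ℂ) + z)⁻¹ * ((r ^ α : ℝ) : ℂ)) • expConv r u t := by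
    intro r hr
    have hr : 0 < r := hr
    have h1 := hrz r hr
    have h2 : ((r ^ α : ℝ) : ℂ) = ((r ^ (α - 1) : ℝ) : ℂ) * r := by
      rw [← Complex.ofReal_mul, Real.rpow_sub_one hr.ne', div_mul_cancel₀ _ hr.ne']
    have h3 : z * (((r : ℂ) + z)⁻¹ * ((r ^ (α - 1) : ℝ) : ℂ))
        = ((r ^ (α - 1) : ℝ) : ℂ) - ((r : ℂ) + z)⁻¹ * ((r ^ α : ℝ) : ℂ) := by
      rw [h2]; field_simp; ring
    rw [smul_sub, smul_sub, smul_sub, sub_add]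
    congr 1
    · simp only [smul_smul, smul_eq_mul]
      ring_nf
    · rw [← Complex.coe_smul (r ^ (α - 1)), ← sub_smul, ← h3]
      simp only [smul_smul]
  have hj1 : IntegrableOn (fun r : ℝ => (((r : ℂ) + z)⁻¹ • ((r ^ (α - 1) : ℝ) : ℂ)) • (z • I))
    (Ioi 0) := hi1.smul_const (z • I)
  have hj2 : IntegrableOn (fun r : ℝ => (((r : ℂ) + z)⁻¹ • ((r ^ (α - 1) : ℝ) : ℂ)) • (z • I)
    - r ^ (α - 1) • expConv r u t) (Ioi 0) := hj1.sub hi2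
  rw [hL, ← integral_smul, setIntegral_congr_fun measurableSet_Ioi hpt,
    integral_add hj2 hi3, integral_sub hj1 hi2,
    integral_smul_const, hsc, he2, ← he3, smul_sub]
  congr 2
  rw [smul_smul, ← Complex.coe_smul, smul_smul, mul_assoc, Complex.cpow_sub _ _ hz0,
    Complex.cpow_one, div_mul_cancel₀ _ hz0]

/-- The continuation of the Carleman transform, for equations of order less than one. -/
theorem extendsAt_carleman {φ : (ℝ≥0 →ᵇ X) →L[ℂ] ℂ}
    (hφ : ∀ h : ℝ≥0 →ᵇ X, Tendsto h atTop (𝓝 0) → φ h = 0) (hα0 : 0 < α) (hα1 : α < 1)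
    {A : X →ₗ.[ℂ] X} {f u : BUC n X} (hf : IsC0 f)
    (hu : IsMildSolution A α (fun t => f t) (fun t => u t))
    {c : ℂ} (hc : c ∈ rhoSet A α) (hcs : c ∈ Complex.slitPlane) :
    ExtendsAt (carleman fun s => φ (shift s (weighted u))) c := by
  obtain ⟨U, hU, hcU, R, hR, hRa⟩ := hc
  have hV : IsOpen (U ∩ Complex.slitPlane) := hU.inter Complex.isOpen_slitPlane
  have hΓ : 0 < Real.Gamma α * Real.Gamma (1 - α) :=
    mul_pos (Real.Gamma_pos_of_pos hα0) (Real.Gamma_pos_of_pos (by linarith))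
  set C : ℝ := Real.Gamma α * Real.Gamma (1 - α) with hC
  refine ⟨fun z => φ (postcomp (R z) ((C⁻¹ : ℂ) • stieltjes (expConvDensity α u) z)), ?_, ?_⟩
  · refine DifferentiableOn.analyticAt (s := U ∩ Complex.slitPlane) (fun z hz => ?_)
      (hV.mem_nhds ⟨hcU, hcs⟩)
    have h1 : DifferentiableAt ℂ R z := (hRa z hz.1).differentiableAt
    have h2 : DifferentiableAt ℂ (stieltjes (expConvDensity α u)) z :=
      differentiableAt_stieltjes (aestronglyMeasurable_expConvDensity α u)
        (integrableOn_expConvDensity hα0 hα1 u) hz.2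
    have h4 : DifferentiableAt ℂ
        (fun z => (C⁻¹ : ℂ) • stieltjes (expConvDensity α u) z) z := h2.const_smul (C⁻¹ : ℂ)
    have h3 : DifferentiableAt ℂ
        (fun z => postcomp (R z) ((C⁻¹ : ℂ) • stieltjes (expConvDensity α u) z)) z :=
      (postcomp.differentiableAt.comp z h1).clm_apply h4
    exact (φ.differentiableAt.comp z h3).differentiableWithinAt
  · filter_upwards [hV.mem_nhds ⟨hcU, hcs⟩] with z hz hz0
    have hT := hR z hz.1
    set q := expConvStieltjes α u z with hq
    have hqc : Continuous q := continuous_expConvStieltjes α u z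
    have hq' : Continuous fun s : ℝ => (C⁻¹ : ℂ) • q s.toNNReal := by fun_prop
    -- The z^α∫u - J^(1-α)u in the equation of q is what (z^α - A)⁻¹ sends to ∫u, up to terms in f
    -- and u(0). The latter carry K, whose derivative t^(-α)/Γ(1-α) tends to 0 because α > 0.
    refine apply_eq_carleman_of_integrated hφ hf hz0 (R z)
      (y := fun t => R z ((C⁻¹ : ℂ) • q t)) (by fun_prop) (fun t => ?_)
      (K := fun t => t ^ (1 - α) / ((1 - α) * Real.Gamma (1 - α)))
      (K' := fun t => t ^ (-α) / Real.Gamma (1 - α)) (fun t ht => ?_) ?_ ?_ (R z (u 0)) fun t => ?_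
    · have hp : (1 + (t : ℝ)) ^ n ≠ 0 := by positivity
      rw [postcomp_apply, BoundedContinuousFunction.smul_apply, hq, expConvStieltjes,
        ← map_smul_real, smul_comm ((1 + (t : ℝ)) ^ n)⁻¹, inv_smul_smul₀ hp]
    · have h1 := (Real.hasDerivAt_rpow_const (x := t) (p := 1 - α) (Or.inl ht.ne')).div_const
        ((1 - α) * Real.Gamma (1 - α))
      refine h1.congr_deriv ?_
      have h2 : 1 - α ≠ 0 := by linarith
      rw [mul_div_mul_left _ _ h2]
      congr 2; ring
    · refine ContinuousOn.div_const (fun t ht => ?_) _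
      exact (Real.continuousAt_rpow_const t (-α) (Or.inl (ne_of_gt ht))).continuousWithinAt
    · simpa using (tendsto_rpow_neg_atTop hα0).div_const (Real.Gamma (1 - α))
    · have h1 := hu.integral_eq hα0 hα1 f.continuous_coe hT t
      have h2 := smul_integral_expConvStieltjes hα0 hα1 u hz.2 t
      have hC0 : (C : ℂ) ≠ 0 := by exact_mod_cast hΓ.ne'
      rw [(R z).intervalIntegral_comp_comm (hq'.intervalIntegrable _ _),
        intervalIntegral.integral_smul, ← map_smul, smul_comm z, h2, ← Complex.coe_smul C,
        smul_add, inv_smul_smul₀ hC0]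
      nth_rewrite 2 [h1]
      simp only [← map_smul_real, map_add, map_sub]
      abel

end

/-! ### Stability -/

section

variable {X : Type*} [NormedAddCommGroup X] [NormedSpace ℂ X]

/-! ### The branch point at the origin -/

/-- The jump of the principal branch across the negative axis. -/
theorem cpow_ne_exp_of_neg {α : ℝ} (hα0 : 0 < α) (hα1 : α < 1) {c : ℂ} (hc : c.re < 0)
    (hc' : c.im = 0) :
    c ^ (α : ℂ) ≠ Complex.exp ((Real.log ‖c‖ - Real.pi * Complex.I) * α) := by
  have hc0 : c ≠ 0 := fun h => by simp [h] at hc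
  rw [Complex.cpow_def_of_ne_zero hc0, Complex.log,
    Complex.arg_eq_pi_iff.2 ⟨hc, hc'⟩, Ne, Complex.exp_eq_exp_iff_exists_int]
  rintro ⟨m, hm⟩
  have hπ : (Real.pi : ℂ) ≠ 0 := by exact_mod_cast Real.pi_ne_zero
  -- The arguments on the two sides of the cut differ by 2πα, so equality would make α an integer
  -- strictly between 0 and 1.
  have h1 : (α : ℂ) = m := by
    have h2 : 2 * (Real.pi * Complex.I) * ((α : ℂ) - m) = 0 := by linear_combination hm
    have h3 : 2 * (Real.pi * Complex.I) ≠ 0 := by simp [hπ]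
    exact sub_eq_zero.1 ((mul_eq_zero.1 h2).resolve_left h3)
  have h2 : α = m := by exact_mod_cast h1
  have h3 : (0 : ℝ) < m := h2 ▸ hα0
  have h4 : (m : ℝ) < 1 := h2 ▸ hα1
  norm_cast at h3 h4
  omega

/-- For orders less than one, `0` is a regular point only on the trivial space. -/
theorem eq_zero_of_zero_mem_rhoSet {A : X →ₗ.[ℂ] X} {α : ℝ} (hα0 : 0 < α) (hα1 : α < 1)
    (h0 : (0 : ℂ) ∈ rhoSet A α) (x : X) : x = 0 := by
  obtain ⟨U, hU, h0U, R, hR, hRa⟩ := h0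
  obtain ⟨ε, hε, hεU⟩ : ∃ ε : ℝ, 0 < ε ∧ ((-ε : ℝ) : ℂ) ∈ U := by
    have h1 : Tendsto (fun ε : ℝ => ((-ε : ℝ) : ℂ)) (𝓝[>] 0) (𝓝 0) := by
      have : Continuous fun ε : ℝ => ((-ε : ℝ) : ℂ) := by fun_prop
      simpa using (this.tendsto 0).mono_left nhdsWithin_le_nhds
    obtain ⟨ε, h2, h3⟩ := ((h1.eventually (hU.mem_nhds h0U)).and self_mem_nhdsWithin).exists
    exact ⟨ε, h3, h2⟩
  set c : ℂ := ((-ε : ℝ) : ℂ) with hc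
  have hcre : c.re < 0 := by simpa [hc] using hε
  have hcim : c.im = 0 := Complex.ofReal_im _
  have hl : Tendsto (fun t : ℝ => c - t * Complex.I) (𝓝[>] 0) (𝓝[{z | z.im < 0}] c) := by
    refine tendsto_nhdsWithin_iff.2 ⟨?_, ?_⟩
    · have : Continuous fun t : ℝ => c - t * Complex.I := by fun_prop
      simpa using (this.tendsto 0).mono_left nhdsWithin_le_nhds
    · filter_upwards [self_mem_nhdsWithin] with t ht
      simpa [hcim] using ht
  have hl' := hl.mono_right nhdsWithin_le_nhds
  have hw : Tendsto (fun t : ℝ => (c - t * Complex.I) ^ (α : ℂ)) (𝓝[>] 0)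
      (𝓝 (Complex.exp ((Real.log ‖c‖ - Real.pi * Complex.I) * α))) := by
    have h1 := (Complex.continuous_exp.tendsto _).comp
      (((Complex.tendsto_log_nhdsWithin_im_neg_of_re_neg_of_im_zero hcre hcim).comp hl).mul_const
        (α : ℂ))
    refine h1.congr' ?_
    filter_upwards [self_mem_nhdsWithin] with t ht
    have ht : 0 < t := ht
    have hne : c - t * Complex.I ≠ 0 := fun h => by
      have := congrArg Complex.im h
      simp [hcim] at this
      exact ht.ne' this
    rw [Complex.cpow_def_of_ne_zero hne]
    rfl
  -- Approaching the cut from below, R(z) → R(c) while z^α tends to a value different from c^α. So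
  -- R(c) is a left inverse for two distinct shifts of A, and subtracting kills the domain; as R(c)
  -- is also a right inverse, the domain and then X are trivial.
  have hdom : ∀ y : A.domain, R c y = 0 := fun y => by
    have h1 : Tendsto (fun t : ℝ => R (c - t * Complex.I)
        ((c - t * Complex.I) ^ (α : ℂ) • (y : X) - A y)) (𝓝[>] 0)
        (𝓝 (R c (Complex.exp ((Real.log ‖c‖ - Real.pi * Complex.I) * α) • (y : X) - A y))) :=
      (isBoundedBilinearMap_apply.continuous.tendsto (R c, _)).comp
        (((hRa c hεU).continuousAt.tendsto.comp hl').prodMk_nhds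
          ((hw.smul_const (y : X)).sub_const (A y)))
    have h2 : R c (Complex.exp ((Real.log ‖c‖ - Real.pi * Complex.I) * α) • (y : X) - A y) = y := by
      refine tendsto_nhds_unique h1 (tendsto_const_nhds.congr' ?_)
      filter_upwards [hl'.eventually (hU.mem_nhds hεU)] with t ht
      exact ((hR _ ht).2 y).symm
    have h3 := (hR c hεU).2 y
    have h4 := h3.trans h2.symm
    rw [map_sub, map_sub, map_smul, map_smul, sub_left_inj, ← sub_eq_zero, ← sub_smul] at h4
    exact (smul_eq_zero.1 h4).resolve_left (sub_ne_zero.2 (cpow_ne_exp_of_neg hα0 hα1 hcre hcim))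
  have hdom' : ∀ y : A.domain, y = 0 := fun y => by
    obtain ⟨h, hy⟩ := (hR c hεU).1 y
    have h1 : (⟨R c y, h⟩ : A.domain) = 0 := Subtype.ext (hdom y)
    rw [h1, A.map_zero, hdom, smul_zero, sub_zero] at hy
    exact Subtype.ext hy.symm
  obtain ⟨h, hx⟩ := (hR c hεU).1 x
  have h1 := hdom' ⟨R c x, h⟩
  have h2 : R c x = 0 := congrArg Subtype.val h1
  rw [h1, A.map_zero, h2, smul_zero, sub_zero] at hx
  exact hx.symm

/-! ### Duality and conclusion -/

/-- The bounded functions that vanish at infinity. -/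
def vanishingSubmodule (X : Type*) [NormedAddCommGroup X] [NormedSpace ℂ X] :
    Submodule ℂ (ℝ≥0 →ᵇ X) where
  carrier := {h | Tendsto h atTop (𝓝 0)}
  zero_mem' := tendsto_const_nhds
  add_mem' := fun {g h} hg hh => by
    have := Tendsto.add (show Tendsto g atTop (𝓝 0) from hg) (show Tendsto h atTop (𝓝 0) from hh)
    rwa [add_zero] at this
  smul_mem' := fun c _ hh => by simpa using Tendsto.const_smul hh c

/-- A bounded function vanishes at infinity if it is annihilated by every functional that
annihilates the functions vanishing at infinity. -/
theorem tendsto_zero_of_forall_functional {w : ℝ≥0 →ᵇ X}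
    (H : ∀ φ : (ℝ≥0 →ᵇ X) →L[ℂ] ℂ,
      (∀ h : ℝ≥0 →ᵇ X, Tendsto h atTop (𝓝 0) → φ h = 0) → φ w = 0) :
    Tendsto w atTop (𝓝 0) := by
  -- Hahn-Banach in the quotient, which is used only as a seminormed space: distance zero is turned
  -- into membership by the ε/2 argument that follows.
  have hq : ‖(vanishingSubmodule X).mkQ w‖ = 0 := by
    by_contra hne
    obtain ⟨g, -, hg⟩ := exists_dual_vector ℂ ((vanishingSubmodule X).mkQ w) hne
    have h1 := H (g.comp (vanishingSubmodule X).mkQL) fun h hh => by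
      have : (vanishingSubmodule X).mkQ h = 0 := (Submodule.Quotient.mk_eq_zero _).2 hh
      change g ((vanishingSubmodule X).mkQ h) = 0
      rw [this, map_zero]
    have h2 : g ((vanishingSubmodule X).mkQ w) = 0 := h1
    rw [hg] at h2
    exact hne (Complex.ofReal_eq_zero.1 h2)
  rw [Metric.tendsto_nhds]
  intro ε hε
  obtain ⟨m, hm, hmε⟩ :=
    Submodule.Quotient.norm_mk_lt ((vanishingSubmodule X).mkQ w) (half_pos hε)
  rw [hq, zero_add] at hmε
  have hm' : Tendsto (m - w) atTop (𝓝 0) := (Submodule.Quotient.eq _).1 hm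
  filter_upwards [Metric.tendsto_nhds.1 hm' _ (half_pos hε)] with t ht
  rw [dist_zero_right] at ht ⊢
  calc ‖w t‖ = ‖m t - (m - w) t‖ := by simp
    _ ≤ ‖m t‖ + ‖(m - w) t‖ := norm_sub_le _ _
    _ < ε := by linarith [m.norm_coe_le_norm t]

variable [CompleteSpace X] {n : ℕ}

/-- The Carleman transform of a mild solution extends across the regular points on the axis. -/
theorem extendsAt_carleman_of_mem_rhoSet {φ : (ℝ≥0 →ᵇ X) →L[ℂ] ℂ}
    (hφ : ∀ h : ℝ≥0 →ᵇ X, Tendsto h atTop (𝓝 0) → φ h = 0) {α : ℝ} (hα0 : 0 < α) (hα1 : α ≤ 1)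
    {A : X →ₗ.[ℂ] X} {f u : BUC n X} (hf : IsC0 f)
    (hu : IsMildSolution A α (fun t => f t) (fun t => u t))
    {c : ℂ} (hc : c ∈ rhoSet A α) (hre : c.re = 0) :
    ExtendsAt (carleman fun s => φ (shift s (weighted u))) c := by
  obtain rfl | hα1 := hα1.eq_or_lt
  · exact extendsAt_carleman_one hφ hf hu hc
  -- The origin is the only point of the imaginary axis outside the slit plane.
  by_cases h0 : c = 0
  · subst h0
    have hX : ∀ h : ℝ≥0 →ᵇ X, h = 0 := fun h =>
      BoundedContinuousFunction.ext fun t => eq_zero_of_zero_mem_rhoSet hα0 hα1 hc _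
    refine ⟨fun _ => 0, analyticAt_const, Eventually.of_forall fun z _ => ?_⟩
    have h1 : (fun s => φ (shift s (weighted u))) = fun _ => 0 := funext fun s => by
      rw [hX (shift s (weighted u)), map_zero]
    rw [h1]
    simp [carleman, laplace]
  · refine extendsAt_carleman hφ hα0 hα1 hf hu hc (Complex.mem_slitPlane_iff.2 (Or.inr ?_))
    exact fun him => h0 (Complex.ext hre him)

end

end FracStab

end

theorem mainTheorem1 {X : Type*} [NormedAddCommGroup X] [NormedSpace ℂ X] [CompleteSpace X]
    (n : ℕ) (α : ℝ) (hα0 : 0 < α) (hα1 : α ≤ 1)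
    (A : X →ₗ.[ℂ] X) (hA : A.IsClosed)
    (f u : FracStab.BUC n X) (hf : FracStab.IsC0 f)
    (hu : FracStab.IsMildSolution A α (fun t => f t) (fun t => u t))
    (hcount : (FracStab.sigmaSet A α ∩ {z : ℂ | z.re = 0}).Countable)
    (herg : ∀ η : ℝ, Complex.I * (η : ℂ) ∈ FracStab.sigmaSet A α →
      FracStab.HasErgodicMean η u 0) :
    Tendsto (fun t : ℝ≥0 => ((1 + (t : ℝ)) ^ n)⁻¹ • u t) atTop (𝓝 0) := by
  refine FracStab.tendsto_zero_of_forall_functional (w := FracStab.weighted u) fun φ hφ => ?_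
  have hcont := φ.continuous.comp
    (FracStab.continuous_shift (FracStab.uniformContinuous_weighted u))
  -- The value at s = 0 is φ of the weighted u, and the exceptional set is Σ(A, α) ∩ iℝ itself.
  have h0 := FracStab.apply_zero_eq_zero_of_countable_spectrum
    (U := fun s => φ (FracStab.shift s (FracStab.weighted u))) (M := ‖φ‖ * ‖FracStab.weighted u‖)
    hcont (fun s => (φ.le_opNorm _).trans (by gcongr; exact FracStab.norm_shift_le _ _)) hcount
    (fun c hre hc => ?_) fun c hc hre => ?_
  · have h1 : FracStab.shift 0 (FracStab.weighted u) = FracStab.weighted u := by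
      ext t
      simp [FracStab.shift_apply]
    simpa only [h1] using h0
  · refine FracStab.extendsAt_carleman_of_mem_rhoSet hφ hα0 hα1 hf hu ?_ hre
    exact by_contra fun h => hc ⟨h, hre⟩
  · have hcI : c = Complex.I * (c.im : ℂ) := Complex.ext (by simp [hre]) (by simp)
    have h1 := FracStab.tendsto_mul_carleman hφ (herg c.im (hcI ▸ hc.1))
    rwa [← hcI] at h1
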